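/- Let $d\ge 2$ and let $\mathbb{L}^d$ be the hypercubic lattice: the graph on $\mathbb{Z}^d$ whose edges join the points at $\ell^1$-distance one. Let $(U_e)_e$ be independent random variables, uniform on $[0,1]$, indexed by the edges of $\mathbb{L}^d$. Consider the constrained-degree percolation process with degree bound $k_v=2$ at every vertex $v$: at time $0$ all edges are closed; an edge $e=\langle u,v\rangle$ tries to open at time $U_e$, and it opens (and stays open from then on) if and only if just before time $U_e$ each of its two endpoints is incident to fewer than $2$ open edges. Almost surely this determines the configuration at every time; the edge $e$ counts as open at time $t$ if its attempt succeeded and $U_e<t$. Let $\theta(t)$ be the probability that infinitely many vertices are connected to the origin by paths of edges that are open at time $t$. Then $\theta(t)=0$ for every $t\in[0,1]$. -/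

import Mathlib

open MeasureTheory

namespace ConstrainedDegree

section Model

variable {V : Type*}

/-- `Earlier G U f e`: the edge `f` shares an endpoint with `e`, and its clock rings strictly
before the clock of `e`. Whether `e` opens depends on such edges `f` only. -/
def Earlier (G : SimpleGraph V) (U : G.edgeSet → unitInterval) (f e : G.edgeSet) : Prop :=
  (∃ x : V, x ∈ (f : Sym2 V) ∧ x ∈ (e : Sym2 V)) ∧ U f < U e

/-- Success of the attempt of the edge `e` at time `U e`, by recursion along `Earlier`: for every
endpoint `x` of `e`, fewer than `k x` edges `⟨x, v⟩` have opened before the time `U e`. -/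
noncomputable def Succeeds (G : SimpleGraph V) (k : V → ℕ) (U : G.edgeSet → unitInterval)
    {e : G.edgeSet} (h : Acc (Earlier G U) e) : Prop :=
  Acc.rec (motive := fun _ _ => Prop)
    (fun (e : G.edgeSet) _ (ih : ∀ f, Earlier G U f e → Prop) => ∀ x ∈ (e : Sym2 V),
      {v : V | ∃ (hv : G.Adj x v) (hf : Earlier G U ⟨s(x, v), hv⟩ e),
        ih ⟨s(x, v), hv⟩ hf}.encard < (k x : ℕ∞)) h

/-- The status of the edge `e` in the temporal configuration at time `t`: it is open iff its clock
has rung before `t` and its attempt succeeded. The recursion runs along the (almost surely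
well-founded, see `ae_forall_acc`) relation `Earlier`. -/
def IsOpenAt (G : SimpleGraph V) (k : V → ℕ) (U : G.edgeSet → unitInterval)
    (t : unitInterval) (e : G.edgeSet) : Prop :=
  U e < t ∧ ∃ h : Acc (Earlier G U) e, Succeeds G k U h

/-- The random graph of the open edges at time `t`. -/
def openGraph (G : SimpleGraph V) (k : V → ℕ) (U : G.edgeSet → unitInterval)
    (t : unitInterval) : SimpleGraph V where
  Adj x y := ∃ h : G.Adj x y, IsOpenAt G k U t ⟨s(x, y), h⟩
  symm := ⟨fun x y ⟨h, ho⟩ => ⟨h.symm, by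
    have he : (⟨s(y, x), h.symm⟩ : G.edgeSet) = ⟨s(x, y), h⟩ := Subtype.ext Sym2.eq_swap
    rw [he]; exact ho⟩⟩
  loopless := ⟨fun _ ⟨h, _⟩ => h.ne rfl⟩

/-- The law of the clocks: the product over all edges of the Lebesgue measure on `[0,1]`. -/
noncomputable def clockLaw (G : SimpleGraph V) : Measure (G.edgeSet → unitInterval) :=
  Measure.infinitePi (fun _ : G.edgeSet => (volume : Measure unitInterval))

/-- The percolation probability at time `t`: the probability that infinitely many vertices are
connected to `o` by paths of edges that are open at time `t`. -/
noncomputable def percolationProb (G : SimpleGraph V) (k : V → ℕ) (o : V)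
    (t : unitInterval) : ENNReal :=
  clockLaw G {U | {v : V | (openGraph G k U t).Reachable o v}.Infinite}

end Model

/-- The hypercubic lattice: vertex set `ℤ^d`, edges between points at `ℓ¹`-distance one. -/
def hypercubicLattice (d : ℕ) : SimpleGraph (Fin d → ℤ) where
  Adj x y := ∑ i, |x i - y i| = 1
  symm := ⟨fun x y h => by simpa only [abs_sub_comm] using h⟩
  loopless := ⟨fun x h => by simp at h⟩

section WellDefined

variable {V : Type*} {G : SimpleGraph V} {k : V → ℕ} {U : G.edgeSet → unitInterval}

theorem succeeds_iff {e : G.edgeSet} (h : Acc (Earlier G U) e) :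
    Succeeds G k U h ↔ ∀ x ∈ (e : Sym2 V),
      {v : V | ∃ (hv : G.Adj x v) (hf : Earlier G U ⟨s(x, v), hv⟩ e),
        Succeeds G k U (h.inv hf)}.encard < (k x : ℕ∞) := by
  cases h with
  | intro _ h => exact Iff.rfl

/-- The recursion that determines the model. -/
theorem isOpenAt_iff {e : G.edgeSet} (h : Acc (Earlier G U) e) (t : unitInterval) :
    IsOpenAt G k U t e ↔ U e < t ∧ ∀ x y : V, (e : Sym2 V) = s(x, y) →
      {v : V | v ≠ y ∧ ∃ hv : G.Adj x v, IsOpenAt G k U (U e) ⟨s(x, v), hv⟩}.encard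
        < (k x : ℕ∞) := by
  have key : ∀ x y : V, (e : Sym2 V) = s(x, y) →
      {v : V | v ≠ y ∧ ∃ hv : G.Adj x v, IsOpenAt G k U (U e) ⟨s(x, v), hv⟩} =
      {v : V | ∃ (hv : G.Adj x v) (hf : Earlier G U ⟨s(x, v), hv⟩ e),
        Succeeds G k U (h.inv hf)} := by
    intro x y hxy
    ext v
    constructor
    · rintro ⟨-, hv, hlt, h', hs⟩
      exact ⟨hv, ⟨⟨x, by simp, by simp [hxy]⟩, hlt⟩, hs⟩
    · rintro ⟨hv, hf, hs⟩
      refine ⟨?_, hv, hf.2, h.inv hf, hs⟩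
      rintro rfl
      have he : e = ⟨s(x, v), hv⟩ := Subtype.ext hxy
      exact absurd hf.2 (by rw [← he]; exact lt_irrefl _)
  have hex : (∃ h : Acc (Earlier G U) e, Succeeds G k U h) ↔ Succeeds G k U h :=
    ⟨fun ⟨_, hs⟩ => hs, fun hs => ⟨h, hs⟩⟩
  unfold IsOpenAt
  rw [hex, succeeds_iff]
  refine and_congr_right fun _ => ⟨fun hs x y hxy => ?_, fun hs x hx => ?_⟩
  · have := hs x (by simp [hxy])
    rw [← key x y hxy] at this
    exact this
  · obtain ⟨y, hy⟩ := hx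
    have := hs x y hy
    rw [← key x y hy]
    exact this

/-- The trails of `n + 1` edges that start with `e` and follow the neighbour lists `nb`. -/
noncomputable def trails {E : Type*} (nb : E → Finset E) : ℕ → E → Finset (List E)
  | 0, e => {[e]}
  | n + 1, e => by
    classical exact (nb e).biUnion fun f => (trails nb n f).image (fun l => e :: l)

theorem card_trails_le {E : Type*} {nb : E → Finset E} {C : ℕ} (hC : ∀ e, (nb e).card ≤ C)
    (n : ℕ) (e : E) : (trails nb n e).card ≤ C ^ n := by
  classical
  induction n generalizing e with
  | zero => simp [trails]
  | succ n ih =>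
    rw [trails, pow_succ']
    exact (Finset.card_biUnion_le_card_mul _ _ (C ^ n)
      fun f _ => Finset.card_image_le.trans (ih f)).trans (Nat.mul_le_mul_right _ (hC e))

theorem length_of_mem_trails {E : Type*} {nb : E → Finset E} {n : ℕ} {e : E} {l : List E}
    (hl : l ∈ trails nb n e) : l.length = n + 1 := by
  classical
  induction n generalizing e l with
  | zero => simp [trails] at hl; simp [hl]
  | succ n ih =>
    simp only [trails, Finset.mem_biUnion, Finset.mem_image] at hl
    obtain ⟨f, -, m, hm, rfl⟩ := hl
    simp [ih hm]

theorem map_mem_trails {E : Type*} {nb : E → Finset E} (n : ℕ) (g : ℕ → E)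
    (hg : ∀ i, g (i + 1) ∈ nb (g i)) : (List.range (n + 1)).map g ∈ trails nb n (g 0) := by
  classical
  induction n generalizing g with
  | zero => simp [trails]
  | succ n ih =>
    rw [List.range_succ_eq_map, List.map_cons, List.map_map, trails]
    simp only [Finset.mem_biUnion, Finset.mem_image]
    exact ⟨g 1, hg 0, _, ih (fun i => g (i + 1)) (fun i => hg (i + 1)), rfl⟩

/-- The model is well defined on a graph in which every edge meets a bounded number of edges:
almost surely no edge starts an infinite chain of adjacent edges with decreasing clocks. -/
theorem ae_forall_acc_of_nb [Countable V] (nb : G.edgeSet → Finset G.edgeSet) (C : ℕ)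
    (hC : ∀ e, (nb e).card ≤ C)
    (hnb : ∀ e f : G.edgeSet, (∃ x : V, x ∈ (f : Sym2 V) ∧ x ∈ (e : Sym2 V)) → f ∈ nb e) :
    ∀ᵐ U ∂(clockLaw G), ∀ e, Acc (Earlier G U) e := by
  classical
  set M : ℕ := 2 * (C + 1) with hM
  have hMpos : (0 : ℝ) < M := by rw [hM]; positivity
  let cell : ℕ → Set unitInterval := fun j => {u | ⌊(M : ℝ) * (u : ℝ)⌋₊ = j}
  have hcellm : ∀ j, MeasurableSet (cell j) := fun j =>
    (Nat.measurable_floor.comp (measurable_const.mul measurable_subtype_coe))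
      (measurableSet_singleton j)
  have hcell : ∀ j, (volume : Measure unitInterval) (cell j) ≤ (M : ENNReal)⁻¹ := by
    intro j
    rw [unitInterval.volume_apply]
    have hsub : Subtype.val '' cell j ⊆ Set.Ico ((j : ℝ) / M) ((j + 1 : ℝ) / M) := by
      rintro _ ⟨u, hu, rfl⟩
      have hu' := (Nat.floor_eq_iff (mul_nonneg hMpos.le u.2.1)).1 hu
      rw [Set.mem_Ico, div_le_iff₀ hMpos, lt_div_iff₀ hMpos, mul_comm (u : ℝ)]
      exact hu'
    refine (measure_mono hsub).trans ?_
    rw [Real.volume_Ico, ← sub_div, add_sub_cancel_left, one_div,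
      ENNReal.ofReal_inv_of_pos hMpos, ENNReal.ofReal_natCast]
  let bad : G.edgeSet → ℕ → ℕ → Set (G.edgeSet → unitInterval) := fun e j n =>
    ⋃ l ∈ (trails nb n e).filter List.Nodup, Set.pi (l.toFinset : Set G.edgeSet) fun _ => cell j
  have hbad : ∀ e j n, clockLaw G (bad e j n) ≤ (2 : ENNReal)⁻¹ ^ n := by
    intro e j n
    have h1 : clockLaw G (bad e j n) ≤
        ∑ l ∈ (trails nb n e).filter List.Nodup, (M : ENNReal)⁻¹ ^ (n + 1) := by
      refine (measure_biUnion_finset_le _ _).trans (Finset.sum_le_sum fun l hl => ?_)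
      rw [Finset.mem_filter] at hl
      rw [clockLaw, Measure.infinitePi_pi _ (fun i _ => hcellm j)]
      refine (Finset.prod_le_prod' fun i _ => hcell j).trans ?_
      rw [Finset.prod_const, List.toFinset_card_of_nodup hl.2, length_of_mem_trails hl.1]
    have h2 : ((trails nb n e).filter List.Nodup).card ≤ (C + 1) ^ n :=
      (Finset.card_filter_le _ _).trans
        ((card_trails_le hC n e).trans (Nat.pow_le_pow_left (Nat.le_succ C) n))
    refine h1.trans ?_
    rw [Finset.sum_const, nsmul_eq_mul]
    have hM1 : (M : ENNReal)⁻¹ ≤ 1 := by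
      rw [ENNReal.inv_le_one]
      exact_mod_cast (by omega : 1 ≤ M)
    have hMC : ((C + 1 : ℕ) : ENNReal) * (M : ENNReal)⁻¹ = 2⁻¹ := by
      rw [hM, Nat.cast_mul, ENNReal.mul_inv (by simp) (by simp), mul_comm, mul_assoc,
        ENNReal.inv_mul_cancel (by simp) (by simp)]
      simp
    calc (((trails nb n e).filter List.Nodup).card : ENNReal) * (M : ENNReal)⁻¹ ^ (n + 1)
        ≤ (((C + 1 : ℕ) : ENNReal)) ^ n * (M : ENNReal)⁻¹ ^ n := by
          rw [pow_succ]
          exact mul_le_mul' (by exact_mod_cast h2) (mul_le_of_le_one_right' hM1)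
      _ = (2 : ENNReal)⁻¹ ^ n := by rw [← mul_pow, hMC]
  have hnull : ∀ e j, clockLaw G (⋂ n, bad e j n) = 0 := by
    intro e j
    have hle : ∀ n : ℕ, clockLaw G (⋂ n, bad e j n) ≤ (2 : ENNReal)⁻¹ ^ n := fun n =>
      (measure_mono (Set.iInter_subset _ n)).trans (hbad e j n)
    exact le_antisymm (ge_of_tendsto'
      (ENNReal.tendsto_pow_atTop_nhds_zero_of_lt_one (by simp)) hle) zero_le
  have hae : ∀ᵐ U ∂(clockLaw G), ∀ e j, U ∉ ⋂ n, bad e j n := by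
    have : Countable G.edgeSet := inferInstance
    rw [ae_all_iff]; intro e
    rw [ae_all_iff]; intro j
    exact measure_eq_zero_iff_ae_notMem.1 (hnull e j)
  filter_upwards [hae] with U hU e
  by_contra hacc
  obtain ⟨f, -, hf⟩ := not_acc_iff_exists_descending_chain.1 hacc
  have hanti : StrictAnti fun n => U (f n) := strictAnti_nat_of_succ_lt fun n => (hf n).2
  have hc : Antitone fun n => ⌊(M : ℝ) * (U (f n) : ℝ)⌋₊ := fun m n hmn =>
    Nat.floor_mono (mul_le_mul_of_nonneg_left (hanti.antitone hmn) hMpos.le)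
  obtain ⟨N, hN⟩ := WellFoundedLT.antitone_chain_condition hc
  refine hU (f N) ⌊(M : ℝ) * (U (f N) : ℝ)⌋₊ (Set.mem_iInter.2 fun n => ?_)
  have hinj : Function.Injective fun i => f (N + i) := fun a b hab => by
    have := hanti.injective (congrArg U hab)
    omega
  refine Set.mem_iUnion₂.2 ⟨(List.range (n + 1)).map fun i => f (N + i), ?_, ?_⟩
  · rw [Finset.mem_filter]
    exact ⟨map_mem_trails n (fun i => f (N + i)) fun i => hnb _ _ (hf (N + i)).1,
      List.nodup_range.map hinj⟩
  · intro g hg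
    simp only [List.coe_toFinset, List.mem_map, Set.mem_ofPred_eq] at hg
    obtain ⟨i, -, rfl⟩ := hg
    exact (hN (N + i) (Nat.le_add_right N i)).symm

/-- The model on the hypercubic lattice is well defined: almost surely, `isOpenAt_iff` applies to
all edges. -/
theorem ae_forall_acc (d : ℕ) : ∀ᵐ U ∂(clockLaw (hypercubicLattice d)),
    ∀ e, Acc (Earlier (hypercubicLattice d) U) e := by
  classical
  let inc : (Fin d → ℤ) → Finset (hypercubicLattice d).edgeSet := fun x =>
    (Finset.Icc (x - 1) (x + 1)).biUnion fun y =>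
      if h : (hypercubicLattice d).Adj x y then {⟨s(x, y), h⟩} else ∅
  have hinc : ∀ x, (inc x).card ≤ 3 ^ d := by
    intro x
    refine (Finset.card_biUnion_le_card_mul _ _ 1 fun y _ => ?_).trans ?_
    · split_ifs <;> simp
    · rw [mul_one, Pi.card_Icc]
      refine (Finset.prod_le_prod' (g := fun _ => 3) fun i _ => ?_).trans (by simp)
      simp only [Pi.sub_apply, Pi.add_apply, Pi.one_apply, Int.card_Icc]
      omega
  have hmem : ∀ x (f : (hypercubicLattice d).edgeSet), x ∈ (f : Sym2 (Fin d → ℤ)) → f ∈ inc x := by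
    rintro x ⟨f, hf⟩ ⟨y, rfl⟩
    have hxy : (hypercubicLattice d).Adj x y := hf
    refine Finset.mem_biUnion.2 ⟨y, ?_, by simp [hxy]⟩
    have hi : ∀ i, |x i - y i| ≤ 1 := fun i =>
      (Finset.single_le_sum (f := fun i => |x i - y i|) (fun i _ => abs_nonneg _)
        (Finset.mem_univ i)).trans_eq hxy
    rw [Finset.mem_Icc]
    constructor <;> intro i <;> have := abs_le.1 (hi i) <;>
      simp only [Pi.sub_apply, Pi.add_apply, Pi.one_apply] <;> omega
  refine ae_forall_acc_of_nb
    (fun e => inc (Quot.out (e : Sym2 (Fin d → ℤ))).1 ∪ inc (Quot.out (e : Sym2 (Fin d → ℤ))).2)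
    (3 ^ d + 3 ^ d) (fun e => ?_) fun e f ⟨x, hxf, hxe⟩ => ?_
  · exact (Finset.card_union_le _ _).trans (add_le_add (hinc _) (hinc _))
  · have he : (e : Sym2 (Fin d → ℤ)) = s((Quot.out (e : Sym2 (Fin d → ℤ))).1,
        (Quot.out (e : Sym2 (Fin d → ℤ))).2) := (Quot.out_eq (e : Sym2 (Fin d → ℤ))).symm
    rw [he, Sym2.mem_iff] at hxe
    rcases hxe with rfl | rfl
    · exact Finset.mem_union_left _ (hmem _ f hxf)
    · exact Finset.mem_union_right _ (hmem _ f hxf)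

end WellDefined

end ConstrainedDegree

/-! With degree bound two, every open cluster is a path or a cycle, so an infinite cluster is a line
without ends or a ray with exactly one end. Both are excluded.

Rays: let the end of each infinite cluster send mass one to every vertex of that cluster. A vertex
receives at most one unit, because two ends in one cluster would make it a finite path. By
translation invariance the expected mass sent is also at most one, whereas an end sends infinite
mass. So almost surely there are no ends (`ae_not_isInfiniteEnd`). The lemmas on measurability of
the open graph serve this exchange of sums.

Lines: if `o` lies in an infinite cluster, the cluster leaves a finite set `S` around `o` by an edge
`vz` and meets infinitely many vertices outside `S` beyond `z`. Inside `S` the open edges can be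
rewired so that the path through `zv` stops at a vertex `c` while every other vertex of `S` has
degree two (`IsFlipPair.nonempty_trap`). If the clocks of the prescribed edges touching `S` ring
early and those of the unwanted edges nearby ring late, the process realises this rewiring, and `c`
is an end of an infinite cluster (`Trap.exists_box`). Only finitely many clocks change, within a box
of positive measure, so finite energy (`ae_exists_resample`) contradicts the absence of ends. -/

namespace ConstrainedDegree

/-! ### Finite energy, genericity and invariance of the clocks -/

section Clocks

variable {V : Type*} {G : SimpleGraph V}

instance isProbabilityMeasure_clockLaw (G : SimpleGraph V) :
    IsProbabilityMeasure (clockLaw G) := by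
  unfold clockLaw; infer_instance

open Classical in
/-- The clocks `W` on `F` and the clocks `U` elsewhere. -/
noncomputable def resample (F : Finset G.edgeSet) (U W : G.edgeSet → unitInterval) :
    G.edgeSet → unitInterval := fun e => if e ∈ F then W e else U e

theorem measurePreserving_resample (F : Finset G.edgeSet) :
    MeasurePreserving (fun p : (G.edgeSet → unitInterval) × (G.edgeSet → unitInterval) =>
      resample F p.1 p.2) ((clockLaw G).prod (clockLaw G)) (clockLaw G) := by
  classical
  have hm : Measurable (fun p : (G.edgeSet → unitInterval) × (G.edgeSet → unitInterval) =>
      resample F p.1 p.2) := by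
    refine measurable_pi_lambda _ fun e => ?_
    unfold resample
    split_ifs
    · exact (measurable_pi_apply e).comp measurable_snd
    · exact (measurable_pi_apply e).comp measurable_fst
  refine ⟨hm, ?_⟩
  refine Measure.eq_infinitePi _ fun s t ht => ?_
  rw [Measure.map_apply hm (.pi s.countable_toSet fun _ _ => ht _)]
  have hpre : (fun p : (G.edgeSet → unitInterval) × (G.edgeSet → unitInterval) =>
      resample F p.1 p.2) ⁻¹' (Set.pi s t) =
      (Set.pi ((s.filter (· ∉ F) : Finset G.edgeSet) : Set G.edgeSet) t) ×ˢ
        (Set.pi ((s.filter (· ∈ F) : Finset G.edgeSet) : Set G.edgeSet) t) := by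
    ext ⟨U, W⟩
    simp only [Set.mem_preimage, Set.mem_pi, Set.mem_prod, Finset.mem_coe, Finset.mem_filter,
      resample]
    constructor
    · intro h
      exact ⟨fun e he => by simpa [he.2] using h e he.1,
        fun e he => by simpa [he.2] using h e he.1⟩
    · rintro ⟨h1, h2⟩ e he
      by_cases hF : e ∈ F
      · simpa [hF] using h2 e ⟨he, hF⟩
      · simpa [hF] using h1 e ⟨he, hF⟩
  rw [hpre, Measure.prod_prod, clockLaw, Measure.infinitePi_pi _ fun i _ => ht i,
    Measure.infinitePi_pi _ fun i _ => ht i, mul_comm, Finset.prod_filter_mul_prod_filter_not]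

/-- Finite energy: almost every clock configuration can be modified on any finite set of edges,
within any box of positive measure, so that a given almost sure property holds. -/
theorem ae_exists_resample [Countable V] {good : (G.edgeSet → unitInterval) → Prop}
    (h : ∀ᵐ U ∂(clockLaw G), good U) :
    ∀ᵐ U ∂(clockLaw G), ∀ (F : Finset G.edgeSet) (I : G.edgeSet → Set unitInterval),
      (∀ e ∈ F, MeasurableSet (I e)) → (∀ e ∈ F, volume (I e) ≠ 0) →
      ∃ W : G.edgeSet → unitInterval, (∀ e ∈ F, W e ∈ I e) ∧ (∀ e ∉ F, W e = U e) ∧ good W := by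
  have : Countable G.edgeSet := inferInstance
  rw [ae_all_iff]
  intro F
  have h1 := (measurePreserving_resample F).quasiMeasurePreserving.ae h
  -- By Fubini, for almost every `U` the resampled clocks are good for almost every `W`. The
  -- exceptional set of `U` depends only on `F`, which ranges over a countable set, so all boxes `I`
  -- are covered at once.
  filter_upwards [Measure.ae_ae_of_ae_prod h1] with U hU I hI hpos
  have hbox : clockLaw G (Set.pi F I) ≠ 0 := by
    rw [clockLaw, Measure.infinitePi_pi _ hI]
    exact Finset.prod_ne_zero_iff.2 hpos
  have hex : ∃ W, W ∈ Set.pi (F : Set G.edgeSet) I ∧ good (resample F U W) := by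
    by_contra! hcon
    exact hbox (measure_mono_null (fun W hW => hcon W hW) hU)
  obtain ⟨W, hW, hg⟩ := hex
  refine ⟨resample F U W, fun e he => ?_, fun e he => ?_, hg⟩
  · simpa [resample, he] using hW e he
  · simp [resample, he]

theorem ae_clock_ne (e : G.edgeSet) (u : unitInterval) : ∀ᵐ U ∂(clockLaw G), U e ≠ u := by
  have h := (measurePreserving_eval_infinitePi
    (fun _ : G.edgeSet => (volume : Measure unitInterval)) e).quasiMeasurePreserving.ae
      (measure_eq_zero_iff_ae_notMem.1 (measure_singleton u))
  exact h

theorem ae_clock_lt_one [Countable V] : ∀ᵐ U ∂(clockLaw G), ∀ e, U e < 1 := by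
  rw [ae_all_iff]
  intro e
  filter_upwards [ae_clock_ne e 1] with U hU
  exact lt_of_le_of_ne unitInterval.le_one' hU

theorem ae_clock_injective [Countable V] :
    ∀ᵐ U ∂(clockLaw G), Function.Injective U := by
  have key : ∀ e f : G.edgeSet, e ≠ f → ∀ᵐ U ∂(clockLaw G), U e ≠ U f := by
    intro e f hef
    have hm : MeasurableSet {U : G.edgeSet → unitInterval | U e ≠ U f} :=
      (measurableSet_eq_fun (measurable_pi_apply e) (measurable_pi_apply f)).compl
    -- Once the clock of `e` alone is resampled, it is independent of the clock of `f`, and a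
    -- uniform variable almost surely avoids a given value.
    have hmp := measurePreserving_resample (G := G) {e}
    rw [← hmp.map_eq, ae_map_iff hmp.measurable.aemeasurable hm]
    refine (Measure.ae_prod_iff_ae_ae (hmp.measurable hm)).2 ?_
    refine Filter.Eventually.of_forall fun U => ?_
    filter_upwards [ae_clock_ne e (U f)] with W hW
    simpa [resample, hef.symm] using hW
  have : ∀ᵐ U ∂(clockLaw G), ∀ e f : G.edgeSet, e ≠ f → U e ≠ U f := by
    simp only [ae_all_iff]
    exact key
  filter_upwards [this] with U hU e f hef
  by_contra hne
  exact hU e f hne hef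

theorem measurePreserving_reindex (σ : Equiv.Perm G.edgeSet) :
    MeasurePreserving (fun (U : G.edgeSet → unitInterval) e => U (σ e))
      (clockLaw G) (clockLaw G) := by
  classical
  have hm : Measurable (fun (U : G.edgeSet → unitInterval) e => U (σ e)) :=
    measurable_pi_lambda _ fun e => measurable_pi_apply (σ e)
  refine ⟨hm, Measure.eq_infinitePi _ fun s t ht => ?_⟩
  rw [Measure.map_apply hm (.pi s.countable_toSet fun _ _ => ht _)]
  have hpre : (fun (U : G.edgeSet → unitInterval) e => U (σ e)) ⁻¹' (Set.pi s t) =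
      Set.pi ((s.map σ.toEmbedding : Finset G.edgeSet) : Set G.edgeSet)
        (fun e => t (σ.symm e)) := by
    ext U
    simp only [Set.mem_preimage, Set.mem_pi, Finset.mem_coe, Finset.mem_map_equiv]
    exact ⟨fun h e he => by simpa using h _ he, fun h e he => by simpa using h (σ e) (by simpa)⟩
  rw [hpre, clockLaw, Measure.infinitePi_pi _ fun i _ => ht _, Finset.prod_map]
  simp

end Clocks


/-! ### The process with degree bound two -/

section BoundTwo

variable {V : Type*} {G : SimpleGraph V} {U : G.edgeSet → unitInterval} {t : unitInterval}

theorem clock_symm (U : G.edgeSet → unitInterval) {x y : V} (h : G.Adj x y) :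
    U ⟨s(y, x), h.symm⟩ = U ⟨s(x, y), h⟩ :=
  congrArg U (Subtype.ext Sym2.eq_swap)

theorem earlier_of_lt {x y a : V} {h : G.Adj x y} {ha : G.Adj x a}
    (hlt : U ⟨s(x, a), ha⟩ < U ⟨s(x, y), h⟩) : Earlier G U ⟨s(x, a), ha⟩ ⟨s(x, y), h⟩ :=
  ⟨⟨x, by simp, by simp⟩, hlt⟩

theorem clock_lt_of_adj {k : V → ℕ} {x y : V} (h : G.Adj x y) (ho : (openGraph G k U t).Adj x y) :
    U ⟨s(x, y), h⟩ < t :=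
  ho.2.1

theorem adj_of_clock_lt {k : V → ℕ} {x y : V} {t' : unitInterval} (h : G.Adj x y)
    (ho : (openGraph G k U t).Adj x y) (hlt : U ⟨s(x, y), h⟩ < t') :
    (openGraph G k U t').Adj x y :=
  ⟨h, hlt, ho.2.2⟩

/-- The recursion of the model for the degree bound `2`. -/
theorem openGraph_adj_iff {x y : V} (h : G.Adj x y) (hacc : Acc (Earlier G U) ⟨s(x, y), h⟩) :
    (openGraph G (fun _ => 2) U t).Adj x y ↔ U ⟨s(x, y), h⟩ < t ∧
      ((openGraph G (fun _ => 2) U (U ⟨s(x, y), h⟩)).neighborSet x).Subsingleton ∧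
      ((openGraph G (fun _ => 2) U (U ⟨s(x, y), h⟩)).neighborSet y).Subsingleton := by
  have key : ∀ a b : V, ∀ hab : G.Adj a b, U ⟨s(a, b), hab⟩ = U ⟨s(x, y), h⟩ →
      ({v : V | v ≠ b ∧ ∃ hv : G.Adj a v,
        IsOpenAt G (fun _ => 2) U (U ⟨s(x, y), h⟩) ⟨s(a, v), hv⟩}.encard < ((2 : ℕ) : ℕ∞) ↔
      ((openGraph G (fun _ => 2) U (U ⟨s(x, y), h⟩)).neighborSet a).Subsingleton) := by
    intro a b hab hU
    have hset : {v : V | v ≠ b ∧ ∃ hv : G.Adj a v,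
        IsOpenAt G (fun _ => 2) U (U ⟨s(x, y), h⟩) ⟨s(a, v), hv⟩} =
        (openGraph G (fun _ => 2) U (U ⟨s(x, y), h⟩)).neighborSet a := by
      ext v
      refine ⟨fun hv => hv.2, fun hv => ⟨?_, hv⟩⟩
      rintro rfl
      exact absurd (clock_lt_of_adj hab hv) (by rw [hU]; exact lt_irrefl _)
    rw [hset, ← Set.encard_le_one_iff_subsingleton]
    have h2 : ((2 : ℕ) : ℕ∞) = 1 + 1 := by norm_num
    rw [h2]
    exact ENat.lt_add_one_iff (by simp)
  have h1 : (openGraph G (fun _ => 2) U t).Adj x y ↔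
      IsOpenAt G (fun _ => 2) U t ⟨s(x, y), h⟩ := ⟨fun ho => ho.2, fun ho => ⟨h, ho⟩⟩
  rw [h1, isOpenAt_iff hacc]
  refine and_congr_right fun _ => ⟨fun hs => ⟨?_, ?_⟩, fun hs a b hab => ?_⟩
  · exact (key x y h rfl).1 (hs x y rfl)
  · exact (key y x h.symm (clock_symm U h)).1 (hs y x Sym2.eq_swap)
  · rcases Sym2.eq_iff.1 hab with ⟨rfl, rfl⟩ | ⟨rfl, rfl⟩
    · exact (key x y h rfl).2 hs.1
    · exact (key y x h.symm (clock_symm U h)).2 hs.2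

/-- A set with at most two elements. -/
def AtMostTwo (s : Set V) : Prop :=
  ∀ a ∈ s, ∀ b ∈ s, ∀ c ∈ s, a = b ∨ a = c ∨ b = c

/-- Of three open edges at `x`, the one with the last clock would have found the other two already
open. Injectivity of the clocks ensures that there is a last one. -/
theorem atMostTwo_neighborSet (hU : Function.Injective U) (hacc : ∀ e, Acc (Earlier G U) e)
    (t : unitInterval) (x : V) : AtMostTwo ((openGraph G (fun _ => 2) U t).neighborSet x) := by
  have last : ∀ a b c : V, ∀ ha : (openGraph G (fun _ => 2) U t).Adj x a,
      ∀ hb : (openGraph G (fun _ => 2) U t).Adj x b,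
      ∀ hc : (openGraph G (fun _ => 2) U t).Adj x c,
      U ⟨s(x, a), ha.1⟩ < U ⟨s(x, c), hc.1⟩ → U ⟨s(x, b), hb.1⟩ < U ⟨s(x, c), hc.1⟩ → a = b := by
    intro a b c ha hb hc hac hbc
    exact ((openGraph_adj_iff hc.1 (hacc _)).1 hc).2.1 (adj_of_clock_lt ha.1 ha hac)
      (adj_of_clock_lt hb.1 hb hbc)
  intro a ha b hb c hc
  have ne : ∀ a b : V, ∀ ha : G.Adj x a, ∀ hb : G.Adj x b, a ≠ b →
      U ⟨s(x, a), ha⟩ ≠ U ⟨s(x, b), hb⟩ := by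
    intro a b ha hb hab h
    have h1 := congrArg Subtype.val (hU h)
    exact hab (Sym2.congr_right.1 h1)
  by_contra! hne
  obtain ⟨hab, hac, hbc⟩ := hne
  have h1 := ne a b ha.1 hb.1 hab
  have h2 := ne a c ha.1 hc.1 hac
  have h3 := ne b c hb.1 hc.1 hbc
  rcases lt_or_gt_of_ne h1 with h1 | h1 <;> rcases lt_or_gt_of_ne h2 with h2 | h2 <;>
    rcases lt_or_gt_of_ne h3 with h3 | h3
  · exact hab (last a b c ha hb hc h2 h3)
  · exact hac (last a c b ha hc hb h1 h3)
  · exact absurd (h1.trans h3) (lt_asymm h2)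
  · exact hac (last a c b ha hc hb h1 h3)
  · exact hab (last a b c ha hb hc h2 h3)
  · exact absurd (h3.trans h1) (lt_asymm h2)
  · exact hbc (last b c a hb hc ha h1 h2)
  · exact hbc (last b c a hb hc ha h1 h2)

end BoundTwo


/-! ### Rewiring a finite set and realising it by clocks -/

section Surgery

variable {V : Type*} {G : SimpleGraph V}

theorem AtMostTwo.mono {s s' : Set V} (h : AtMostTwo s') (hs : s ⊆ s') : AtMostTwo s :=
  fun a ha b hb c hc => h a (hs ha) b (hs hb) c (hs hc)

theorem atMostTwo_pair (a b : V) : AtMostTwo ({a, b} : Set V) := by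
  rintro x (rfl | rfl) y (rfl | rfl) w (rfl | rfl) <;> simp

/-- A plan to lead a path that enters `S` from `z` through `v` to a dead end `c`: every vertex of
`S` is joined to its images under `f` and `g`, so it has two neighbours, except for `c`, which is
fixed by `g`. All neighbours of `c` lie in `S`. -/
structure Trap (G : SimpleGraph V) (S : Set V) (v z : V) where
  f : V → V
  g : V → V
  c : V
  v_mem : v ∈ S
  z_notMem : z ∉ S
  c_mem : c ∈ S
  mem_of_adj : ∀ a, G.Adj c a → a ∈ S
  f_mem : ∀ x ∈ S, f x ∈ S
  f_f : ∀ x ∈ S, f (f x) = x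
  adj_f : ∀ x ∈ S, G.Adj x (f x)
  g_c : g c = c
  g_v : g v = z
  g_mem : ∀ x ∈ S, x ≠ v → g x ∈ S
  g_g : ∀ x ∈ S, x ≠ v → g (g x) = x
  adj_g : ∀ x ∈ S, x ≠ c → G.Adj x (g x)
  g_ne_f : ∀ x ∈ S, g x ≠ f x
  chain : Relation.ReflTransGen (fun x y => x ∈ S ∧ x ≠ y ∧ (y = f x ∨ y = g x)) c z

variable {S : Set V} {v z : V}

/-- The graph `O` with the edges that touch `S` replaced by those of the trap. -/
def Trap.surgery (T : Trap G S v z) (O : SimpleGraph V) : SimpleGraph V where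
  Adj x y := x ≠ y ∧ ((x ∈ S ∧ (y = T.f x ∨ y = T.g x)) ∨ (y ∈ S ∧ (x = T.f y ∨ x = T.g y)) ∨
    (x ∉ S ∧ y ∉ S ∧ O.Adj x y))
  symm := ⟨by
    rintro x y ⟨hne, h | h | h⟩
    · exact ⟨hne.symm, .inr (.inl h)⟩
    · exact ⟨hne.symm, .inl h⟩
    · exact ⟨hne.symm, .inr (.inr ⟨h.2.1, h.1, h.2.2.symm⟩)⟩⟩
  loopless := ⟨fun _ h => h.1 rfl⟩

/-- Edges listed from their other endpoint give nothing new, since `f` and `g` are involutions as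
long as they stay in `S`. -/
theorem Trap.surgery_adj_of_mem (T : Trap G S v z) {O : SimpleGraph V} {x y : V} (hx : x ∈ S) :
    (T.surgery O).Adj x y ↔ x ≠ y ∧ (y = T.f x ∨ y = T.g x) := by
  refine and_congr_right fun hne => ⟨?_, fun h => .inl ⟨hx, h⟩⟩
  rintro (h | ⟨hy, rfl | rfl⟩ | h)
  · exact h.2
  · exact .inl (T.f_f y hy).symm
  · refine .inr (T.g_g y hy ?_).symm
    rintro rfl
    exact T.z_notMem (T.g_v ▸ hx)
  · exact absurd hx h.1

theorem Trap.surgery_adj_of_notMem (T : Trap G S v z) {O : SimpleGraph V} {x y : V} (hx : x ∉ S)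
    (hy : y ∉ S) (hO : O.Adj x y) : (T.surgery O).Adj x y :=
  ⟨hO.ne, .inr (.inr ⟨hx, hy, hO⟩)⟩

/-- The only edge of the surgery that crosses the boundary of `S` is `vz`, and it belongs to `O`
already. Hence no degree outside `S` grows. -/
theorem Trap.adj_of_surgery_adj (T : Trap G S v z) {O : SimpleGraph V} (hvz : O.Adj v z) {x y : V}
    (hx : x ∉ S) (h : (T.surgery O).Adj x y) : O.Adj x y := by
  obtain ⟨hne, h | ⟨hy, rfl | rfl⟩ | h⟩ := h
  · exact absurd h.1 hx
  · exact absurd (T.f_mem y hy) hx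
  · obtain rfl : y = v := by
      by_contra hyv
      exact hx (T.g_mem y hy hyv)
    rw [T.g_v]
    exact hvz.symm
  · exact h.2.2

theorem Trap.surgery_le (T : Trap G S v z) {O : SimpleGraph V} (hO : O ≤ G) (hvz : O.Adj v z) :
    T.surgery O ≤ G := by
  intro x y h
  by_cases hx : x ∈ S
  · obtain ⟨hne, rfl | rfl⟩ := (T.surgery_adj_of_mem hx).1 h
    · exact T.adj_f x hx
    · refine T.adj_g x hx ?_
      rintro rfl
      exact hne T.g_c.symm
  · exact hO (T.adj_of_surgery_adj hvz hx h)

theorem Trap.atMostTwo_surgery (T : Trap G S v z) {O : SimpleGraph V} (hvz : O.Adj v z)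
    (hO : ∀ x, AtMostTwo (O.neighborSet x)) (x : V) :
    AtMostTwo ((T.surgery O).neighborSet x) := by
  by_cases hx : x ∈ S
  · exact (atMostTwo_pair (T.f x) (T.g x)).mono fun y hy => ((T.surgery_adj_of_mem hx).1 hy).2
  · exact (hO x).mono fun y hy => T.adj_of_surgery_adj hvz hx hy

theorem openGraph_le (k : V → ℕ) (U : G.edgeSet → unitInterval) (t : unitInterval) :
    openGraph G k U t ≤ G := fun _ _ h => h.1

theorem Trap.surgery_reachable (T : Trap G S v z) {O : SimpleGraph V} {w : V}
    (hw : Relation.ReflTransGen (fun x y => x ∉ S ∧ y ∉ S ∧ O.Adj x y) z w) :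
    (T.surgery O).Reachable T.c w := by
  have h1 : (T.surgery O).Reachable T.c z := by
    rw [SimpleGraph.reachable_iff_reflTransGen]
    exact Relation.ReflTransGen.mono (fun x y h => (T.surgery_adj_of_mem h.1).2 h.2) _ _ T.chain
  refine h1.trans ?_
  rw [SimpleGraph.reachable_iff_reflTransGen]
  exact Relation.ReflTransGen.mono
    (fun x y h => T.surgery_adj_of_notMem h.1 h.2.1 h.2.2) _ _ hw

variable {U W : G.edgeSet → unitInterval} {t : unitInterval} {D : Set V}

/-- If the clocks `W` ring early on the edges of the trap, late on the other edges around it, and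
agree with `U` elsewhere, then they open the edges prescribed by the surgery. -/
theorem Trap.openGraph_adj_iff_surgery (T : Trap G S v z) (hUinj : Function.Injective U)
    (hUacc : ∀ e, Acc (Earlier G U) e) (hWacc : ∀ e, Acc (Earlier G W) e)
    (hvz : (openGraph G (fun _ => 2) U t).Adj v z)
    (hD : ∀ x ∉ D, ∀ a, G.Adj x a → a ∉ S) (hSD : S ⊆ D)
    (hlow : ∀ x y (h : G.Adj x y), (T.surgery (openGraph G (fun _ => 2) U t)).Adj x y →
      W ⟨s(x, y), h⟩ < t)
    (horder : ∀ x y a (hy : G.Adj x y) (ha : G.Adj x a),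
      (T.surgery (openGraph G (fun _ => 2) U t)).Adj x y →
      ¬ (T.surgery (openGraph G (fun _ => 2) U t)).Adj x a → (x ∈ D ∨ a ∈ D) →
      W ⟨s(x, y), hy⟩ < W ⟨s(x, a), ha⟩)
    (hsame : ∀ x y (h : G.Adj x y), x ∉ S → y ∉ S →
      ((T.surgery (openGraph G (fun _ => 2) U t)).Adj x y ∨ (x ∉ D ∧ y ∉ D)) →
      W ⟨s(x, y), h⟩ = U ⟨s(x, y), h⟩)
    {x y : V} (h : G.Adj x y)
    (hxy : (T.surgery (openGraph G (fun _ => 2) U t)).Adj x y ∨ (x ∉ D ∧ y ∉ D)) :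
    (openGraph G (fun _ => 2) W t).Adj x y ↔
      (T.surgery (openGraph G (fun _ => 2) U t)).Adj x y := by
  have hO := atMostTwo_neighborSet hUinj hUacc t
  have hH := T.atMostTwo_surgery hvz hO
  set O := openGraph G (fun _ => 2) U t with hOdef
  set H := T.surgery O with hHdef
  suffices hmain : ∀ e : G.edgeSet, ∀ x y (h : G.Adj x y), e = ⟨s(x, y), h⟩ →
      (H.Adj x y ∨ (x ∉ D ∧ y ∉ D)) →
      ((openGraph G (fun _ => 2) W t).Adj x y ↔ H.Adj x y) from hmain _ x y h rfl hxy
  clear hxy h x y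
  intro e
  -- Induction along the clocks `W`: the status of an edge depends only on adjacent edges that ring
  -- earlier.
  induction hWacc e with
  | intro e _ ih =>
  rintro x y h rfl hxy
  by_cases hHxy : H.Adj x y
  · refine ⟨fun _ => hHxy, fun _ => (openGraph_adj_iff h (hWacc _)).2 ⟨hlow x y h hHxy, ?_⟩⟩
    -- An edge of `H` is never blocked. Adjacent edges outside `H` ring later if they touch `D` and
    -- are closed by induction otherwise, so only edges of `H` can block it, and `H` has degree at
    -- most two.
    have side : ∀ p q (hpq : G.Adj p q), H.Adj p q →
        (⟨s(p, q), hpq⟩ : G.edgeSet) = ⟨s(x, y), h⟩ →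
        ((openGraph G (fun _ => 2) W (W ⟨s(p, q), hpq⟩)).neighborSet p).Subsingleton := by
      intro p q hpq hHpq hE
      have nb : ∀ a, (openGraph G (fun _ => 2) W (W ⟨s(p, q), hpq⟩)).Adj p a →
          H.Adj p a ∧ a ≠ q := by
        intro a ha
        have hlt := clock_lt_of_adj ha.1 ha
        refine ⟨?_, ?_⟩
        · by_contra hna
          have hnl : p ∉ D ∧ a ∉ D := by
            by_contra hcon
            exact lt_asymm hlt (horder p q a hpq ha.1 hHpq hna (by tauto))
          exact hna ((ih ⟨s(p, a), ha.1⟩ (hE ▸ earlier_of_lt hlt) p a ha.1 rfl (.inr hnl)).1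
            (adj_of_clock_lt ha.1 ha (hlt.trans (hlow p q hpq hHpq))))
        · rintro rfl
          exact lt_irrefl _ hlt
      intro a ha b hb
      obtain ⟨ha, haq⟩ := nb a ha
      obtain ⟨hb, hbq⟩ := nb b hb
      rcases hH p a ha b hb q hHpq with h | h | h
      · exact h
      · exact absurd h haq
      · exact absurd h hbq
    refine ⟨side x y h hHxy rfl, ?_⟩
    have := side y x h.symm hHxy.symm (Subtype.ext Sym2.eq_swap)
    rwa [clock_symm W h] at this
  · have hDxy : x ∉ D ∧ y ∉ D := hxy.resolve_left hHxy
    have hxS : x ∉ S := fun hx => hDxy.1 (hSD hx)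
    have hyS : y ∉ S := fun hy => hDxy.2 (hSD hy)
    refine ⟨fun hW => absurd ?_ hHxy, fun hcon => absurd hcon hHxy⟩
    have hWU := hsame x y h hxS hyS (.inr hDxy)
    -- An edge away from `D` that opens under `W` also opens under `U`: an adjacent edge open
    -- earlier under `U` avoids `S`, so it survives in `H` and by induction is open under `W` as
    -- well. Thus `U` obstructs no more than `W` does.
    have side : ∀ p q (hpq : G.Adj p q), (⟨s(p, q), hpq⟩ : G.edgeSet) = ⟨s(x, y), h⟩ → p ∉ D →
        U ⟨s(p, q), hpq⟩ < t →
        W ⟨s(p, q), hpq⟩ = U ⟨s(p, q), hpq⟩ →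
        ((openGraph G (fun _ => 2) W (W ⟨s(p, q), hpq⟩)).neighborSet p).Subsingleton →
        ((openGraph G (fun _ => 2) U (U ⟨s(p, q), hpq⟩)).neighborSet p).Subsingleton := by
      intro p q hpq hE hp ht hWUpq hsub
      have hpS : p ∉ S := fun hp' => hp (hSD hp')
      have nb : ∀ a, (openGraph G (fun _ => 2) U (U ⟨s(p, q), hpq⟩)).Adj p a →
          (openGraph G (fun _ => 2) W (W ⟨s(p, q), hpq⟩)).Adj p a := by
        intro a ha
        have hlt := clock_lt_of_adj ha.1 ha
        have haS := hD p hp a ha.1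
        have hHa : H.Adj p a :=
          T.surgery_adj_of_notMem hpS haS (adj_of_clock_lt ha.1 ha (hlt.trans ht))
        have hWUa := hsame p a ha.1 hpS haS (.inl hHa)
        have hltW : W ⟨s(p, a), ha.1⟩ < W ⟨s(p, q), hpq⟩ := by rwa [hWUa, hWUpq]
        exact adj_of_clock_lt ha.1
          ((ih ⟨s(p, a), ha.1⟩ (hE ▸ earlier_of_lt hltW) p a ha.1 rfl (.inl hHa)).2 hHa) hltW
      exact fun a ha b hb => hsub (nb a ha) (nb b hb)
    have hUt : U ⟨s(x, y), h⟩ < t := hWU ▸ clock_lt_of_adj h hW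
    obtain ⟨-, h1, h2⟩ := (openGraph_adj_iff h (hWacc _)).1 hW
    refine T.surgery_adj_of_notMem hxS hyS ((openGraph_adj_iff h (hUacc _)).2 ⟨hUt, ?_, ?_⟩)
    · exact side x y h rfl hDxy.1 hUt hWU h1
    · have := side y x h.symm (Subtype.ext Sym2.eq_swap) hDxy.2
      rw [clock_symm W h, clock_symm U h] at this
      exact this hUt hWU h2

theorem finite_edges_touching (hfin : ∀ x, (G.neighborSet x).Finite) {D : Set V} (hD : D.Finite) :
    {e : G.edgeSet | ∃ x ∈ D, x ∈ (e : Sym2 V)}.Finite := by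
  have hpairs : (⋃ x ∈ D, (fun y => s(x, y)) '' G.neighborSet x).Finite :=
    hD.biUnion fun x _ => (hfin x).image _
  refine Set.Finite.of_finite_image (f := Subtype.val) (hpairs.subset ?_)
    Subtype.val_injective.injOn
  rintro _ ⟨⟨e, he⟩, ⟨x, hx, y, rfl⟩, rfl⟩
  exact Set.mem_biUnion hx ⟨y, he, rfl⟩

theorem finite_closedNeighborhood (hfin : ∀ x, (G.neighborSet x).Finite) {D : Set V}
    (hD : D.Finite) : {x | x ∈ D ∨ ∃ a ∈ D, G.Adj a x}.Finite := by
  refine (hD.union (hD.biUnion fun x _ => hfin x)).subset ?_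
  rintro x (hx | ⟨a, ha, hax⟩)
  · exact .inl hx
  · exact .inr (Set.mem_biUnion ha hax)

theorem volume_Ioi_ne_zero {s : unitInterval} (hs : s < 1) : volume (Set.Ioi s) ≠ 0 := by
  rw [unitInterval.volume_Ioi]
  simpa using hs

theorem volume_Iio_ne_zero {s : unitInterval} (hs : 0 < s) : volume (Set.Iio s) ≠ 0 := by
  rw [unitInterval.volume_Iio]
  simpa using hs

/-- Setting the clocks of finitely many edges to suitable intervals makes the end of the trap the
end of an infinite open path. -/
theorem Trap.exists_box (T : Trap G S v z) (hfin : ∀ x, (G.neighborSet x).Finite)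
    (hS : S.Finite) (hUinj : Function.Injective U) (hUacc : ∀ e, Acc (Earlier G U) e)
    (hU1 : ∀ e, U e < 1) (hvz : (openGraph G (fun _ => 2) U t).Adj v z)
    (hinf : {w | Relation.ReflTransGen
      (fun x y => x ∉ S ∧ y ∉ S ∧ (openGraph G (fun _ => 2) U t).Adj x y) z w}.Infinite) :
    ∃ (F : Finset G.edgeSet) (I : G.edgeSet → Set unitInterval),
      (∀ e ∈ F, MeasurableSet (I e)) ∧ (∀ e ∈ F, volume (I e) ≠ 0) ∧
      ∀ W : G.edgeSet → unitInterval, (∀ e ∈ F, W e ∈ I e) → (∀ e ∉ F, W e = U e) →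
        (∀ e, Acc (Earlier G W) e) →
        ((openGraph G (fun _ => 2) W t).neighborSet T.c).Subsingleton ∧
        {y | (openGraph G (fun _ => 2) W t).Reachable T.c y}.Infinite := by
  classical
  set O := openGraph G (fun _ => 2) U t with hOdef
  set H := T.surgery O with hHdef
  have hHG : H ≤ G := T.surgery_le (openGraph_le _ _ _) hvz
  set D : Set V := {x | x ∈ S ∨ ∃ a ∈ S, G.Adj a x} with hDdef
  set D' : Set V := {x | x ∈ D ∨ ∃ a ∈ D, G.Adj a x} with hD'def
  have hDfin : D.Finite := finite_closedNeighborhood hfin hS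
  have hD'fin : D'.Finite := finite_closedNeighborhood hfin hDfin
  have hSD : S ⊆ D := fun x hx => .inl hx
  have hDn : ∀ x ∉ D, ∀ a, G.Adj x a → a ∉ S := fun x hx a hxa ha => hx (.inr ⟨a, ha, hxa.symm⟩)
  -- The level `s` separates early from late. It bounds the clocks `U` on edges touching `D'` rather
  -- than only `D`, because a late edge that touches `D` may compete with edges of `H` at its other
  -- endpoint.
  obtain ⟨s, hs0, hs1, hsU⟩ : ∃ s : unitInterval, 0 < s ∧ s < 1 ∧
      ∀ e : G.edgeSet, (∃ x ∈ D', x ∈ (e : Sym2 V)) → U e < s := by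
    have hfinE := finite_edges_touching hfin hD'fin
    have hsup : hfinE.toFinset.sup U < 1 := (Finset.sup_lt_iff (bot_lt_iff_ne_bot.2 fun h => zero_ne_one h.symm)).2 fun e _ => hU1 e
    obtain ⟨s, hs, hs1⟩ := exists_between hsup
    refine ⟨s, bot_le.trans_lt hs, hs1, fun e he => lt_of_le_of_lt ?_ hs⟩
    exact Finset.le_sup (f := U) (hfinE.mem_toFinset.2 he)
  have ht0 : 0 < t := lt_of_le_of_lt bot_le (clock_lt_of_adj hvz.1 hvz)
  -- Edges of `H` with both endpoints off `S` are left out, so the old path beyond `z` keeps its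
  -- clocks.
  have hFfin : {e : G.edgeSet | (∃ x ∈ D, x ∈ (e : Sym2 V)) ∧
      ((e : Sym2 V) ∉ H.edgeSet ∨ ∃ x ∈ S, x ∈ (e : Sym2 V))}.Finite :=
    (finite_edges_touching hfin hDfin).subset fun e he => he.1
  refine ⟨hFfin.toFinset,
    fun e => if (e : Sym2 V) ∈ H.edgeSet then Set.Iio (min t s) else Set.Ioi s,
    fun e _ => ?_, fun e _ => ?_, fun W hWF hWU hWacc => ?_⟩
  · dsimp only
    split_ifs
    exacts [measurableSet_Iio, measurableSet_Ioi]
  · dsimp only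
    split_ifs
    exacts [volume_Iio_ne_zero (lt_min ht0 hs0), volume_Ioi_ne_zero hs1]
  have hlate : ∀ x a (ha : G.Adj x a), ¬ H.Adj x a → (x ∈ D ∨ a ∈ D) → s < W ⟨s(x, a), ha⟩ := by
    intro x a ha hna hDxa
    have hmem : (⟨s(x, a), ha⟩ : G.edgeSet) ∈ hFfin.toFinset := by
      refine hFfin.mem_toFinset.2 ⟨?_, .inl hna⟩
      rcases hDxa with h | h
      · exact ⟨x, h, by simp⟩
      · exact ⟨a, h, by simp⟩
    have := hWF _ hmem
    dsimp only at this
    rw [if_neg (show s(x, a) ∉ H.edgeSet from hna)] at this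
    exact this
  have hearly : ∀ x y (hy : G.Adj x y), H.Adj x y → (x ∈ S ∨ y ∈ S) →
      W ⟨s(x, y), hy⟩ < min t s := by
    intro x y hy hH hSxy
    have hmem : (⟨s(x, y), hy⟩ : G.edgeSet) ∈ hFfin.toFinset := by
      refine hFfin.mem_toFinset.2 ?_
      rcases hSxy with h | h
      · exact ⟨⟨x, hSD h, by simp⟩, .inr ⟨x, h, by simp⟩⟩
      · exact ⟨⟨y, hSD h, by simp⟩, .inr ⟨y, h, by simp⟩⟩
    have := hWF _ hmem
    dsimp only at this
    rw [if_pos (show s(x, y) ∈ H.edgeSet from hH)] at this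
    exact this
  have hsame : ∀ x y (h : G.Adj x y), x ∉ S → y ∉ S → (H.Adj x y ∨ (x ∉ D ∧ y ∉ D)) →
      W ⟨s(x, y), h⟩ = U ⟨s(x, y), h⟩ := by
    intro x y h hx hy hor
    refine hWU _ fun hmem => ?_
    obtain ⟨⟨p, hpD, hp⟩, hq⟩ := hFfin.mem_toFinset.1 hmem
    have hp' : p = x ∨ p = y := by simpa using hp
    rcases hq with hq | ⟨q, hqS, hq⟩
    · rcases hor with hor | hor
      · exact hq hor
      · rcases hp' with rfl | rfl
        exacts [hor.1 hpD, hor.2 hpD]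
    · have hq' : q = x ∨ q = y := by simpa using hq
      rcases hq' with rfl | rfl
      exacts [hx hqS, hy hqS]
  have hlow : ∀ x y (h : G.Adj x y), H.Adj x y → W ⟨s(x, y), h⟩ < t := by
    intro x y h hH
    by_cases hxy : x ∈ S ∨ y ∈ S
    · exact (hearly x y h hH hxy).trans_le (min_le_left _ _)
    · push Not at hxy
      rw [hsame x y h hxy.1 hxy.2 (.inl hH)]
      exact clock_lt_of_adj h (T.adj_of_surgery_adj hvz hxy.1 hH)
  have hbefore : ∀ x y (h : G.Adj x y), H.Adj x y → x ∈ D' → W ⟨s(x, y), h⟩ < s := by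
    intro x y h hH hx
    by_cases hxy : x ∈ S ∨ y ∈ S
    · exact (hearly x y h hH hxy).trans_le (min_le_right _ _)
    · push Not at hxy
      rw [hsame x y h hxy.1 hxy.2 (.inl hH)]
      exact hsU _ ⟨x, hx, by simp⟩
  have horder : ∀ x y a (hy : G.Adj x y) (ha : G.Adj x a), H.Adj x y → ¬ H.Adj x a →
      (x ∈ D ∨ a ∈ D) → W ⟨s(x, y), hy⟩ < W ⟨s(x, a), ha⟩ := by
    intro x y a hy ha hH hna hor
    refine (hbefore x y hy hH ?_).trans (hlate x a ha hna hor)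
    rcases hor with h | h
    exacts [.inl h, .inr ⟨a, h, ha.symm⟩]
  have key := fun {x y : V} => T.openGraph_adj_iff_surgery (x := x) (y := y) hUinj hUacc hWacc hvz
    hDn hSD hlow horder hsame
  have hHW : H ≤ openGraph G (fun _ => 2) W t := fun x y h => (key (hHG h) (.inl h)).2 h
  constructor
  · have hnb : ∀ a, (openGraph G (fun _ => 2) W t).Adj T.c a → a = T.f T.c := by
      intro a ha
      by_cases hHa : H.Adj T.c a
      · obtain ⟨hne, h | h⟩ := (T.surgery_adj_of_mem T.c_mem).1 hHa
        · exact h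
        · exact absurd (h.trans T.g_c).symm hne
      · exfalso
        -- An edge at `c` outside the trap leads to some `a` in `S`, which already has two open trap
        -- edges before time `s`. The late edge is therefore blocked.
        have haS := T.mem_of_adj a ha.1
        have hclock := hlate T.c a ha.1 hHa (.inl (hSD T.c_mem))
        have hsub := ((openGraph_adj_iff ha.1 (hWacc _)).1 ha).2.2
        have hmem : ∀ b, H.Adj a b →
            (openGraph G (fun _ => 2) W (W ⟨s(T.c, a), ha.1⟩)).Adj a b := fun b hb =>
          adj_of_clock_lt (hHG hb) (hHW hb)
            ((hbefore a b (hHG hb) hb (.inl (hSD haS))).trans hclock)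
        have hf : H.Adj a (T.f a) :=
          (T.surgery_adj_of_mem haS).2 ⟨(T.adj_f a haS).ne, .inl rfl⟩
        have hg : H.Adj a (T.g a) :=
          (T.surgery_adj_of_mem haS).2 ⟨(T.adj_g a haS ha.ne').ne, .inr rfl⟩
        exact T.g_ne_f a haS (hsub (hmem _ hg) (hmem _ hf))
    intro a ha b hb
    rw [hnb a ha, hnb b hb]
  · exact hinf.mono fun w hw => (T.surgery_reachable hw).mono hHW

end Surgery


/-! ### Measurability of the open graph -/

section Measurability

variable {V : Type*} {G : SimpleGraph V} {U : G.edgeSet → unitInterval} {t : unitInterval}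

/-- The `n`-th iterate of the recursion of the model with degree bound `2`. -/
def succeedsUpTo (U : G.edgeSet → unitInterval) : ℕ → G.edgeSet → Prop
  | 0, _ => False
  | n + 1, e => ∀ x ∈ (e : Sym2 V), ∀ v w (hv : G.Adj x v) (hw : G.Adj x w),
      U ⟨s(x, v), hv⟩ < U e → U ⟨s(x, w), hw⟩ < U e →
      succeedsUpTo U n ⟨s(x, v), hv⟩ → succeedsUpTo U n ⟨s(x, w), hw⟩ → v = w

theorem measurable_succeedsUpTo [Countable V] (n : ℕ) (e : G.edgeSet) :
    Measurable fun U : G.edgeSet → unitInterval => succeedsUpTo U n e := by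
  induction n generalizing e with
  | zero => exact measurable_const
  | succ n ih =>
    have hlt : ∀ f, Measurable fun U : G.edgeSet → unitInterval => U f < U e := fun f =>
      measurableSet_setOfPred.1 (measurableSet_lt (measurable_pi_apply f) (measurable_pi_apply e))
    simp only [succeedsUpTo]
    exact .forall fun x => .forall fun _ => .forall fun v => .forall fun w => .forall fun hv =>
      .forall fun hw => (hlt _).imp ((hlt _).imp ((ih _).imp ((ih _).imp measurable_const)))

theorem exists_succeeds_iff {e : G.edgeSet} (hacc : Acc (Earlier G U) e) :
    (∃ h : Acc (Earlier G U) e, Succeeds G (fun _ => 2) U h) ↔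
      ∀ x ∈ (e : Sym2 V), ∀ v w (hv : G.Adj x v) (hw : G.Adj x w),
        U ⟨s(x, v), hv⟩ < U e → U ⟨s(x, w), hw⟩ < U e →
        (∃ h : Acc (Earlier G U) ⟨s(x, v), hv⟩, Succeeds G (fun _ => 2) U h) →
        (∃ h : Acc (Earlier G U) ⟨s(x, w), hw⟩, Succeeds G (fun _ => 2) U h) → v = w := by
  have hex : (∃ h : Acc (Earlier G U) e, Succeeds G (fun _ => 2) U h) ↔
      Succeeds G (fun _ => 2) U hacc := ⟨fun ⟨_, hs⟩ => hs, fun hs => ⟨hacc, hs⟩⟩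
  rw [hex, succeeds_iff]
  refine forall_congr' fun x => forall_congr' fun hx => ?_
  have h2 : ((2 : ℕ) : ℕ∞) = 1 + 1 := by norm_num
  rw [h2, ENat.lt_add_one_iff (by simp), Set.encard_le_one_iff]
  constructor
  · rintro h v w hv hw hvlt hwlt ⟨_, hsv⟩ ⟨_, hsw⟩
    exact h v w ⟨hv, ⟨⟨x, by simp, hx⟩, hvlt⟩, hsv⟩ ⟨hw, ⟨⟨x, by simp, hx⟩, hwlt⟩, hsw⟩
  · rintro h v w ⟨hv, hvE, hsv⟩ ⟨hw, hwE, hsw⟩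
    exact h v w hv hw hvE.2 hwE.2 ⟨_, hsv⟩ ⟨_, hsw⟩

/-- An edge has finitely many adjacent edges, so accessibility settles its status after finitely
many iterations, and the default `False` at stage `0` is immaterial. -/
theorem eventually_succeedsUpTo_iff (hfin : ∀ x, (G.neighborSet x).Finite) {e : G.edgeSet}
    (hacc : Acc (Earlier G U) e) :
    ∃ N, ∀ n ≥ N, (succeedsUpTo U n e ↔
      ∃ h : Acc (Earlier G U) e, Succeeds G (fun _ => 2) U h) := by
  induction hacc with
  | intro e h ih =>
  have hfinE : {f | Earlier G U f e}.Finite := by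
    have : {x | x ∈ (e : Sym2 V)}.Finite := by
      obtain ⟨⟨x, y⟩, -⟩ := e
      exact (Set.toFinite {x, y}).subset fun a ha => by simpa using ha
    exact (finite_edges_touching hfin this).subset fun f hf =>
      let ⟨x, hxf, hxe⟩ := hf.1
      ⟨x, hxe, hxf⟩
  have hev : ∀ᶠ n in Filter.atTop, ∀ f ∈ {f | Earlier G U f e}, (succeedsUpTo U n f ↔
      ∃ h : Acc (Earlier G U) f, Succeeds G (fun _ => 2) U h) :=
    (Filter.eventually_all_finite hfinE).2 fun f hf => Filter.eventually_atTop.2 (ih f hf)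
  obtain ⟨N, hN⟩ := Filter.eventually_atTop.1 hev
  refine ⟨N + 1, fun n hn => ?_⟩
  obtain ⟨m, rfl⟩ : ∃ m, n = m + 1 := ⟨n - 1, by omega⟩
  rw [exists_succeeds_iff (Acc.intro e h), succeedsUpTo]
  refine forall_congr' fun x => forall_congr' fun hx => forall_congr' fun v => forall_congr' fun w =>
    forall_congr' fun hv => forall_congr' fun hw => forall_congr' fun hvlt =>
    forall_congr' fun hwlt => ?_
  rw [hN m (by omega) ⟨s(x, v), hv⟩ ⟨⟨x, by simp, hx⟩, hvlt⟩,
    hN m (by omega) ⟨s(x, w), hw⟩ ⟨⟨x, by simp, hx⟩, hwlt⟩]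

/-- Recursion on accessibility is not visibly measurable, but almost surely it is the limit of its
finite stages, which are. -/
theorem nullMeasurableSet_adj [Countable V] (hfin : ∀ x, (G.neighborSet x).Finite)
    (hacc : ∀ᵐ U ∂(clockLaw G), ∀ e, Acc (Earlier G U) e) (t : unitInterval) (x y : V) :
    NullMeasurableSet {U | (openGraph G (fun _ => 2) U t).Adj x y} (clockLaw G) := by
  by_cases h : G.Adj x y
  · have hm : Measurable fun U : G.edgeSet → unitInterval =>
        U ⟨s(x, y), h⟩ < t ∧ ∃ N, ∀ n, N ≤ n → succeedsUpTo U n ⟨s(x, y), h⟩ :=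
      (measurableSet_setOfPred.1 (measurableSet_lt (measurable_pi_apply _) measurable_const)).and
        (.exists fun N => .forall fun n => .forall fun _ => measurable_succeedsUpTo n _)
    refine (measurableSet_setOfPred.2 hm).nullMeasurableSet.congr ?_
    filter_upwards [hacc] with U hU
    refine propext ?_
    change (U ⟨s(x, y), h⟩ < t ∧ ∃ N, ∀ n, N ≤ n → succeedsUpTo U n ⟨s(x, y), h⟩) ↔
      (openGraph G (fun _ => 2) U t).Adj x y
    obtain ⟨N, hN⟩ := eventually_succeedsUpTo_iff hfin (hU ⟨s(x, y), h⟩)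
    constructor
    · rintro ⟨hlt, M, hM⟩
      exact ⟨h, hlt, (hN (max M N) (le_max_right _ _)).1 (hM _ (le_max_left _ _))⟩
    · rintro ⟨_, hlt, hs⟩
      exact ⟨hlt, N, fun n hn => (hN n hn).2 hs⟩
  · have : {U | (openGraph G (fun _ => 2) U t).Adj x y} = ∅ :=
      Set.eq_empty_of_forall_notMem fun U hU => h hU.1
    rw [this]
    exact .empty

theorem nullMeasurableSet_reachable [Countable V] (hfin : ∀ x, (G.neighborSet x).Finite)
    (hacc : ∀ᵐ U ∂(clockLaw G), ∀ e, Acc (Earlier G U) e) (t : unitInterval) (x y : V) :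
    NullMeasurableSet {U | (openGraph G (fun _ => 2) U t).Reachable x y} (clockLaw G) := by
  have hwalk : ∀ (n : ℕ) (x : V), NullMeasurableSet
      {U | ∃ p : (openGraph G (fun _ => 2) U t).Walk x y, p.length = n} (clockLaw G) := by
    intro n
    induction n with
    | zero =>
      intro x
      have : {U | ∃ p : (openGraph G (fun _ => 2) U t).Walk x y, p.length = 0} =
          {_U | x = y} := by
        ext U
        exact ⟨fun ⟨p, hp⟩ => SimpleGraph.Walk.eq_of_length_eq_zero hp,
          fun (h : x = y) => h ▸ ⟨.nil, rfl⟩⟩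
      rw [this]
      exact (measurableSet_setOfPred.2 measurable_const).nullMeasurableSet
    | succ n ih =>
      intro x
      have : {U | ∃ p : (openGraph G (fun _ => 2) U t).Walk x y, p.length = n + 1} =
          ⋃ w, {U | (openGraph G (fun _ => 2) U t).Adj x w} ∩
            {U | ∃ p : (openGraph G (fun _ => 2) U t).Walk w y, p.length = n} := by
        ext U
        simp only [Set.mem_iUnion]
        constructor
        · rintro ⟨p, hp⟩
          cases p with
          | nil => simp at hp
          | cons h q => exact ⟨_, h, q, by simpa using hp⟩
        · rintro ⟨w, h, q, hq⟩
          exact ⟨.cons h q, by simpa using hq⟩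
      rw [this]
      exact .iUnion fun w => (nullMeasurableSet_adj hfin hacc t x w).inter (ih w)
  have : {U | (openGraph G (fun _ => 2) U t).Reachable x y} =
      ⋃ n, {U | ∃ p : (openGraph G (fun _ => 2) U t).Walk x y, p.length = n} := by
    ext U
    simp only [Set.mem_iUnion]
    exact ⟨fun ⟨p⟩ => ⟨_, p, rfl⟩, fun ⟨_, p, _⟩ => ⟨p⟩⟩
  rw [this]
  exact .iUnion fun n => hwalk n x

end Measurability

/-! ### Ends of infinite clusters and their invariance -/

section Ends

variable {V : Type*} {G : SimpleGraph V} {U : G.edgeSet → unitInterval} {t : unitInterval}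

/-- The vertex `c` has at most one neighbour and its cluster is infinite. -/
def IsInfiniteEnd (O : SimpleGraph V) (c : V) : Prop :=
  (O.neighborSet c).Subsingleton ∧ {y | O.Reachable c y}.Infinite

theorem nullMeasurableSet_isInfiniteEnd [Countable V] (hfin : ∀ x, (G.neighborSet x).Finite)
    (hacc : ∀ᵐ U ∂(clockLaw G), ∀ e, Acc (Earlier G U) e) (t : unitInterval) (c : V) :
    NullMeasurableSet {U | IsInfiniteEnd (openGraph G (fun _ => 2) U t) c} (clockLaw G) := by
  have : {U | IsInfiniteEnd (openGraph G (fun _ => 2) U t) c} =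
      (⋂ a, ⋂ b, ⋂ _ : a ≠ b, ({U | (openGraph G (fun _ => 2) U t).Adj c a} ∩
        {U | (openGraph G (fun _ => 2) U t).Adj c b})ᶜ) ∩
      ⋂ F : Finset V, ⋃ y, ⋃ _ : y ∉ F, {U | (openGraph G (fun _ => 2) U t).Reachable c y} := by
    ext U
    simp only [Set.mem_inter_iff, Set.mem_iInter, Set.mem_iUnion]
    refine and_congr ⟨fun h a b hab hU => hab (h hU.1 hU.2), fun h a ha b hb => ?_⟩
      ⟨fun h F => ?_, fun h hf => ?_⟩
    · by_contra hab
      exact h a b hab ⟨ha, hb⟩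
    · obtain ⟨y, hy, hyF⟩ := Set.Infinite.exists_notMem_finset h F
      exact ⟨y, hyF, hy⟩
    · obtain ⟨y, hyF, hy⟩ := h hf.toFinset
      exact hyF (hf.mem_toFinset.2 hy)
  rw [this]
  refine .inter (.iInter fun a => .iInter fun b => .iInter fun _ => ?_)
    (.iInter fun F => .iUnion fun y => .iUnion fun _ => nullMeasurableSet_reachable hfin hacc t c y)
  exact ((nullMeasurableSet_adj hfin hacc t c a).inter (nullMeasurableSet_adj hfin hacc t c b)).compl

/-- Along the path both neighbours of each vertex are accounted for, and `b` has only one. The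
cluster can continue only through `w`. -/
theorem adj_mem_support_of_isPath {O : SimpleGraph V} (hO : ∀ x, AtMostTwo (O.neighborSet x))
    {u b w : V} (p : O.Walk u b) (hp : p.IsPath) (hw : w ∉ p.support) (huw : O.Adj u w)
    (hb : (O.neighborSet b).Subsingleton) :
    ∀ x ∈ p.support, ∀ y, O.Adj x y → y ∈ p.support ∨ y = w := by
  induction p generalizing w with
  | nil =>
    intro x hx y hxy
    obtain rfl : x = _ := by simpa using hx
    exact .inr (hb hxy huw)
  | @cons u u1 b h q ih =>
    rw [SimpleGraph.Walk.cons_isPath_iff] at hp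
    rw [SimpleGraph.Walk.support_cons, List.mem_cons, not_or] at hw
    intro x hx y hxy
    rw [SimpleGraph.Walk.support_cons, List.mem_cons] at hx ⊢
    rcases hx with rfl | hx
    · rcases hO x w huw u1 h y hxy with rfl | rfl | rfl
      · exact absurd q.start_mem_support hw.2
      · exact .inr rfl
      · exact .inl (.inr q.start_mem_support)
    · rcases ih hp.1 hp.2 h.symm hb x hx y hxy with hy | rfl
      exacts [.inl (.inr hy), .inl (.inl rfl)]

/-- A path between two distinct ends is closed under adjacency, so it would be the whole cluster,
which would then be finite. -/
theorem IsInfiniteEnd.eq_of_reachable {O : SimpleGraph V}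
    (hO : ∀ x, AtMostTwo (O.neighborSet x)) {a b : V} (ha : IsInfiniteEnd O a)
    (hb : IsInfiniteEnd O b) (hab : O.Reachable a b) : a = b := by
  classical
  obtain ⟨p, hp⟩ := hab.exists_isPath
  cases p with
  | nil => rfl
  | @cons _ u _ h q =>
    exfalso
    rw [SimpleGraph.Walk.cons_isPath_iff] at hp
    have hclosed := adj_mem_support_of_isPath hO q hp.1 hp.2 h.symm hb.1
    refine ha.2 ((insert a q.support.toFinset).finite_toSet.subset fun y hy => ?_)
    simp only [Finset.coe_insert, List.coe_toFinset]
    have hy' : O.Reachable a y := hy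
    rw [SimpleGraph.reachable_iff_reflTransGen] at hy'
    induction hy' with
    | refl => exact .inl rfl
    | @tail x y _ hxy ih =>
      rcases ih ((SimpleGraph.reachable_iff_reflTransGen _ _).2 ‹_›) with rfl | hx
      · rw [ha.1 hxy h]
        exact .inr q.start_mem_support
      · rcases hclosed x hx y hxy with hy | rfl
        exacts [.inr hy, .inl rfl]

/-- The recursion uses only adjacency and the order of the clocks, so it commutes with
automorphisms. The proof is by induction along the clocks. -/
theorem openGraph_adj_iff_of_iso (φ : G ≃g G) (hacc : ∀ e, Acc (Earlier G U) e)
    (t : unitInterval) (x y : V) :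
    (openGraph G (fun _ => 2) (fun e => U (φ.mapEdgeSet e)) t).Adj x y ↔
      (openGraph G (fun _ => 2) U t).Adj (φ x) (φ y) := by
  set U' : G.edgeSet → unitInterval := fun e => U (φ.mapEdgeSet e) with hU'
  have hclock : ∀ a b (h : G.Adj a b), U' ⟨s(a, b), h⟩ = U ⟨s(φ a, φ b), φ.map_adj_iff.2 h⟩ :=
    fun _ _ _ => rfl
  have hsub : Subrelation (Earlier G U') (InvImage (Earlier G U) φ.mapEdgeSet) := by
    rintro f e ⟨⟨a, haf, hae⟩, hlt⟩
    exact ⟨⟨φ a, Sym2.mem_map.2 ⟨a, haf, rfl⟩, Sym2.mem_map.2 ⟨a, hae, rfl⟩⟩, hlt⟩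
  have hacc' : ∀ e, Acc (Earlier G U') e := fun e => hsub.accessible (InvImage.accessible _ (hacc _))
  suffices hmain : ∀ e : G.edgeSet, ∀ x y (h : G.Adj x y), e = ⟨s(x, y), h⟩ → ∀ t,
      ((openGraph G (fun _ => 2) U' t).Adj x y ↔
        (openGraph G (fun _ => 2) U t).Adj (φ x) (φ y)) by
    by_cases h : G.Adj x y
    · exact hmain _ x y h rfl t
    · exact iff_of_false (fun hc => h hc.1) fun hc => h (φ.map_adj_iff.1 hc.1)
  clear t x y
  intro e
  induction hacc' e with
  | intro e _ ih =>
  rintro x y h rfl t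
  rw [openGraph_adj_iff h (hacc' _), openGraph_adj_iff (φ.map_adj_iff.2 h) (hacc _), ← hclock x y h]
  have side : ∀ p q (hpq : G.Adj p q), (⟨s(p, q), hpq⟩ : G.edgeSet) = ⟨s(x, y), h⟩ →
      (((openGraph G (fun _ => 2) U' (U' ⟨s(x, y), h⟩)).neighborSet p).Subsingleton ↔
        ((openGraph G (fun _ => 2) U (U' ⟨s(x, y), h⟩)).neighborSet (φ p)).Subsingleton) := by
    intro p q hpq hE
    have nb : ∀ a, (openGraph G (fun _ => 2) U' (U' ⟨s(x, y), h⟩)).Adj p a ↔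
        (openGraph G (fun _ => 2) U (U' ⟨s(x, y), h⟩)).Adj (φ p) (φ a) := by
      intro a
      by_cases ha : G.Adj p a
      · by_cases hlt : U' ⟨s(p, a), ha⟩ < U' ⟨s(x, y), h⟩
        · refine ih ⟨s(p, a), ha⟩ ?_ p a ha rfl _
          rw [← hE]
          rw [← hE] at hlt
          exact earlier_of_lt hlt
        · refine iff_of_false (fun hc => hlt (clock_lt_of_adj ha hc)) fun hc => hlt ?_
          exact clock_lt_of_adj (φ.map_adj_iff.2 ha) hc
      · exact iff_of_false (fun hc => ha hc.1) fun hc => ha (φ.map_adj_iff.1 hc.1)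
    constructor
    · intro hs a ha b hb
      obtain ⟨a, rfl⟩ := φ.surjective a
      obtain ⟨b, rfl⟩ := φ.surjective b
      rw [hs ((nb a).2 ha) ((nb b).2 hb)]
    · intro hs a ha b hb
      exact φ.injective (hs ((nb a).1 ha) ((nb b).1 hb))
  exact and_congr_right fun _ => and_congr (side x y h rfl)
    (side y x h.symm (Subtype.ext Sym2.eq_swap))

theorem IsInfiniteEnd.map_iff {O O' : SimpleGraph V} (ψ : O' ≃g O) (c : V) :
    IsInfiniteEnd O (ψ c) ↔ IsInfiniteEnd O' c := by
  have h1 : O.neighborSet (ψ c) = ψ '' O'.neighborSet c := by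
    ext y
    obtain ⟨y, rfl⟩ := ψ.surjective y
    rw [ψ.injective.mem_set_image]
    exact ψ.map_adj_iff
  have h2 : {y | O.Reachable (ψ c) y} = ψ '' {y | O'.Reachable c y} := by
    ext y
    obtain ⟨y, rfl⟩ := ψ.surjective y
    rw [ψ.injective.mem_set_image]
    exact SimpleGraph.Iso.reachable_iff
  unfold IsInfiniteEnd
  rw [h1, h2, ψ.injective.subsingleton_image_iff, Set.infinite_image_iff ψ.injective.injOn]

theorem measure_isInfiniteEnd_inter_reachable [Countable V]
    (hfin : ∀ x, (G.neighborSet x).Finite)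
    (hacc : ∀ᵐ U ∂(clockLaw G), ∀ e, Acc (Earlier G U) e) (φ : G ≃g G) (t : unitInterval)
    (c y : V) :
    clockLaw G {U | IsInfiniteEnd (openGraph G (fun _ => 2) U t) (φ c) ∧
        (openGraph G (fun _ => 2) U t).Reachable (φ c) (φ y)} =
      clockLaw G {U | IsInfiniteEnd (openGraph G (fun _ => 2) U t) c ∧
        (openGraph G (fun _ => 2) U t).Reachable c y} := by
  refine Eq.trans (measure_congr ?_) ((measurePreserving_reindex φ.mapEdgeSet).measure_preimage
    ((nullMeasurableSet_isInfiniteEnd hfin hacc t c).inter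
      (nullMeasurableSet_reachable hfin hacc t c y)))
  filter_upwards [hacc] with U hU
  refine propext ?_
  let ψ : openGraph G (fun _ => 2) (fun e => U (φ.mapEdgeSet e)) t ≃g openGraph G (fun _ => 2) U t :=
    ⟨φ.toEquiv, fun {x y} => (openGraph_adj_iff_of_iso φ hU t x y).symm⟩
  exact and_congr (IsInfiniteEnd.map_iff ψ c) (SimpleGraph.Iso.reachable_iff (φ := ψ))

end Ends

/-! ### Mass transport on the lattice -/

section Lattice

variable {d : ℕ}

/-- The translation of the lattice by `a`. -/
def translation (a : Fin d → ℤ) : hypercubicLattice d ≃g hypercubicLattice d where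
  toEquiv := Equiv.addRight a
  map_rel_iff' := by
    intro x y
    simp [hypercubicLattice]

theorem finite_neighborSet_hypercubicLattice (x : Fin d → ℤ) :
    ((hypercubicLattice d).neighborSet x).Finite := by
  refine (Set.finite_Icc (x - 1) (x + 1)).subset fun y hxy => ?_
  have hi : ∀ i, |x i - y i| ≤ 1 := fun i =>
    (Finset.single_le_sum (f := fun i => |x i - y i|) (fun i _ => abs_nonneg _)
      (Finset.mem_univ i)).trans_eq hxy
  rw [Set.mem_Icc]
  constructor <;> intro i <;> have := abs_le.1 (hi i) <;>
    simp only [Pi.sub_apply, Pi.add_apply, Pi.one_apply] <;> omega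

/-- By mass transport, almost surely no infinite cluster has an end. -/
theorem ae_not_isInfiniteEnd (d : ℕ) (t : unitInterval) :
    ∀ᵐ U ∂(clockLaw (hypercubicLattice d)), ∀ c,
      ¬ IsInfiniteEnd (openGraph (hypercubicLattice d) (fun _ => 2) U t) c := by
  rw [ae_all_iff]
  intro c
  have hfin := finite_neighborSet_hypercubicLattice (d := d)
  have hacc := ae_forall_acc d
  set A : (Fin d → ℤ) → (Fin d → ℤ) → Set ((hypercubicLattice d).edgeSet → unitInterval) :=
    fun c y => {U | IsInfiniteEnd (openGraph (hypercubicLattice d) (fun _ => 2) U t) c ∧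
      (openGraph (hypercubicLattice d) (fun _ => 2) U t).Reachable c y} with hA
  have hAm : ∀ c y, NullMeasurableSet (A c y) (clockLaw (hypercubicLattice d)) := fun c y =>
    (nullMeasurableSet_isInfiniteEnd hfin hacc t c).inter
      (nullMeasurableSet_reachable hfin hacc t c y)
  have hshift : ∀ y, clockLaw (hypercubicLattice d) (A c y) =
      clockLaw (hypercubicLattice d) (A (c - y) 0) := by
    intro y
    have := measure_isInfiniteEnd_inter_reachable hfin hacc (translation (-y)) t c y
    have h1 : translation (-y) c = c - y := (sub_eq_add_neg c y).symm
    have h2 : translation (-y) y = 0 := add_neg_cancel y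
    rw [h1, h2] at this
    exact this.symm
  -- The origin receives mass from at most one end, since its cluster has at most one.
  have hdisj : Pairwise (Function.onFun (AEDisjoint (clockLaw (hypercubicLattice d)))
      fun y => A (c - y) 0) := by
    intro y y' hne
    rw [Function.onFun, AEDisjoint, measure_eq_zero_iff_ae_notMem]
    filter_upwards [ae_clock_injective, hacc] with U hinj hU hcon
    refine hne (sub_right_injective ((hcon.1.1.eq_of_reachable
      (atMostTwo_neighborSet hinj hU t) hcon.2.1 (hcon.1.2.trans hcon.2.2.symm)) : c - y = c - y'))
  have hsum : ∑' y, clockLaw (hypercubicLattice d) (A c y) ≠ ⊤ := by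
    simp_rw [hshift]
    refine ne_top_of_le_ne_top ?_ (tsum_measure_le_measure_univ (fun y => hAm (c - y) 0) hdisj)
    simp
  -- Borel–Cantelli: almost surely `c` sends mass to finitely many vertices only, but an infinite
  -- end sends it to infinitely many.
  filter_upwards [ae_finite_setOfPred_mem hsum] with U hU hend
  exact hend.2 (hU.subset fun y hy => ⟨hend, hy⟩)

end Lattice


/-! ### Building a trap from four-cycles -/

section BlockTrap

variable {V : Type*} {G : SimpleGraph V}

/-- Two commuting involutions that move every vertex to distinct neighbours. Their orbits are
`4`-cycles. -/
structure IsFlipPair (G : SimpleGraph V) (f h : V → V) : Prop where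
  f_f : ∀ x, f (f x) = x
  h_h : ∀ x, h (h x) = x
  comm : ∀ x, f (h x) = h (f x)
  adj_f : ∀ x, G.Adj x (f x)
  adj_h : ∀ x, G.Adj x (h x)
  f_ne_h : ∀ x, f x ≠ h x

theorem IsFlipPair.symm {f h : V → V} (H : IsFlipPair G f h) : IsFlipPair G h f :=
  ⟨H.h_h, H.f_f, fun x => (H.comm x).symm, H.adj_h, H.adj_f, fun x => (H.f_ne_h x).symm⟩

/-- The set `S` is a union of four-cycles, and `v` and `q` lie on different ones. Cutting the edges
from `v` to `h v` and from `q` to `h q` turns these two cycles into paths. Joining `h v` to `q` and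
`v` to `z` makes one path that enters from `z` and stops at `h q`; the other cycles stay. So `g` is
`h` altered at four vertices. -/
theorem IsFlipPair.nonempty_trap {f h : V → V} (H : IsFlipPair G f h) {S : Set V} {v z q : V}
    (hSf : ∀ x ∈ S, f x ∈ S) (hSh : ∀ x ∈ S, h x ∈ S) (hv : v ∈ S) (hz : z ∉ S) (hvz : G.Adj v z)
    (hq : q ∈ S) (hvq : G.Adj (h v) q) (hqv : q ≠ v) (hqh : q ≠ h v) (hqf : q ≠ f v)
    (hqfh : q ≠ f (h v)) (hc : ∀ a, G.Adj (h q) a → a ∈ S) : Nonempty (Trap G S v z) := by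
  classical
  obtain ⟨hff, hhh, hcomm, hadjf, hadjh, hfh⟩ := H
  have hnf : ∀ x, f x ≠ x := fun x => (hadjf x).ne'
  have hnh : ∀ x, h x ≠ x := fun x => (hadjh x).ne'
  set g : V → V := fun x => if x = v then z else if x = h v then q else if x = q then h v else
    if x = h q then h q else h x with hg
  have hinj : ∀ x y, h x = y → x = h y := fun x y hxy => by rw [← hxy, hhh]
  have finj : ∀ x y, f x = y → x = f y := fun x y hxy => by rw [← hxy, hff]
  have g1 : g v = z := by simp [hg]
  have g2 : g (h v) = q := by simp [hg, hnh v]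
  have g3 : g q = h v := by simp [hg, hqv, hqh]
  have g4 : g (h q) = h q := by
    have e1 : h q ≠ v := fun e => hqh (hinj _ _ e)
    have e2 : h q ≠ h v := fun e => hqv (by rw [hinj _ _ e, hhh])
    simp [hg, e1, e2, hnh q]
  have g5 : ∀ x, x ≠ v → x ≠ h v → x ≠ q → x ≠ h q → g x = h x := by
    intro x h1 h2 h3 h4
    simp [hg, h1, h2, h3, h4]
  have g6 : g (f (h q)) = f q := by
    rw [g5, ← hcomm, hhh]
    · exact fun e => hqfh (by rw [hinj _ _ (finj _ _ e), hcomm])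
    · exact fun e => hqf (by rw [hinj _ _ (finj _ _ e), hcomm, hhh])
    · exact fun e => hfh q (finj _ _ e).symm
    · exact hnf _
  have g7 : g (f (h v)) = f v := by
    rw [g5, ← hcomm, hhh]
    · exact fun e => hfh v (finj _ _ e).symm
    · exact hnf _
    · exact hqfh.symm
    · exact fun e => hqf (by rw [← hhh q, ← e, hcomm, hhh])
  refine ⟨⟨f, g, h q, hv, hz, hSh q hq, hc, hSf, fun x _ => hff x, fun x _ => hadjf x, g4, g1,
    fun x hx hxv => ?_, fun x hx hxv => ?_, fun x hx hxc => ?_, fun x hx => ?_, ?_⟩⟩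
  · by_cases h2 : x = h v
    · rwa [h2, g2]
    by_cases h3 : x = q
    · rw [h3, g3]
      exact hSh v hv
    by_cases h4 : x = h q
    · rw [h4, g4]
      exact hSh q hq
    · rw [g5 x hxv h2 h3 h4]
      exact hSh x hx
  · by_cases h2 : x = h v
    · rw [h2, g2, g3]
    by_cases h3 : x = q
    · rw [h3, g3, g2]
    by_cases h4 : x = h q
    · rw [h4, g4, g4]
    · rw [g5 x hxv h2 h3 h4, g5 (h x), hhh]
      · exact fun e => h2 (hinj _ _ e)
      · exact fun e => hxv (by rw [hinj _ _ e, hhh])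
      · exact fun e => h4 (hinj _ _ e)
      · exact fun e => h3 (by rw [hinj _ _ e, hhh])
  · by_cases h1 : x = v
    · rwa [h1, g1]
    by_cases h2 : x = h v
    · rwa [h2, g2]
    by_cases h3 : x = q
    · rw [h3, g3]
      exact hvq.symm
    · rw [g5 x h1 h2 h3 hxc]
      exact hadjh x
  · by_cases h1 : x = v
    · rw [h1, g1]
      exact fun e => hz (e ▸ hSf v hv)
    by_cases h2 : x = h v
    · rwa [h2, g2]
    by_cases h3 : x = q
    · rw [h3, g3]
      exact fun e => hqfh (by rw [e, hff])
    by_cases h4 : x = h q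
    · rw [h4, g4]
      exact (hnf _).symm
    · rw [g5 x h1 h2 h3 h4]
      exact (hfh x).symm
  · have stepf : ∀ x ∈ S, x ∈ S ∧ x ≠ f x ∧ (f x = f x ∨ f x = g x) := fun x hx =>
      ⟨hx, (hnf x).symm, .inl rfl⟩
    have stepg : ∀ x ∈ S, ∀ y, x ≠ y → g x = y → x ∈ S ∧ x ≠ y ∧ (y = f x ∨ y = g x) :=
      fun x hx y hne hy => ⟨hx, hne, .inr hy.symm⟩
    -- The path visits `h q`, `f (h q)`, `f q`, `q`, `h v`, `f (h v)`, `f v`, `v`, `z`.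
    refine .tail (.tail (.tail (.tail (.tail (.tail (.tail (.single
      (stepf (h q) (hSh q hq))) (stepg _ (hSf _ (hSh q hq)) (f q) ?_ g6)) ?_)
      (stepg q hq (h v) hqh g3)) (stepf (h v) (hSh v hv)))
      (stepg _ (hSf _ (hSh v hv)) (f v) ?_ g7)) ?_) (stepg v hv z ?_ g1)
    · rw [hcomm]
      exact hnh _
    · exact ⟨hSf q hq, hnf q, .inl (hff q).symm⟩
    · rw [hcomm]
      exact hnh _
    · exact ⟨hSf v hv, hnf v, .inl (hff v).symm⟩
    · exact fun e => hz (e ▸ hv)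

/-- The orbit of `x` under a flip pair. -/
def block (f h : V → V) (x : V) : Set V := {x, f x, h x, f (h x)}

/-- The union of the blocks that meet the block of `o` or its neighbourhood. -/
def blockNeighborhood (G : SimpleGraph V) (f h : V → V) (o : V) : Set V :=
  ⋃ y ∈ {y | y ∈ block f h o ∨ ∃ b ∈ block f h o, G.Adj b y}, block f h y

theorem finite_block (f h : V → V) (x : V) : (block f h x).Finite := by
  unfold block
  exact Set.toFinite _

theorem finite_blockNeighborhood (hfin : ∀ x, (G.neighborSet x).Finite) (f h : V → V) (o : V) :
    (blockNeighborhood G f h o).Finite :=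
  (finite_closedNeighborhood hfin (finite_block f h o)).biUnion fun y _ => finite_block f h y

theorem self_mem_block (f h : V → V) (x : V) : x ∈ block f h x := .inl rfl

theorem IsFlipPair.mem_block_iff {f h : V → V} (H : IsFlipPair G f h) {x y : V} :
    (f y ∈ block f h x ↔ y ∈ block f h x) ∧ (h y ∈ block f h x ↔ y ∈ block f h x) := by
  have hf : ∀ y ∈ block f h x, f y ∈ block f h x := by
    rintro y (rfl | rfl | rfl | rfl)
    · exact .inr (.inl rfl)
    · exact .inl (H.f_f _)
    · exact .inr (.inr (.inr rfl))
    · exact .inr (.inr (.inl (H.f_f _)))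
  have hh : ∀ y ∈ block f h x, h y ∈ block f h x := by
    rintro y (rfl | rfl | rfl | rfl)
    · exact .inr (.inr (.inl rfl))
    · exact .inr (.inr (.inr (H.comm _).symm))
    · exact .inl (H.h_h _)
    · exact .inr (.inl (by rw [H.comm, H.h_h]))
  exact ⟨⟨fun hy => H.f_f y ▸ hf _ hy, hf y⟩, ⟨fun hy => H.h_h y ▸ hh _ hy, hh y⟩⟩

/-- If one of two flips preserves each given adjacency, then every edge that leaves the
neighbourhood of a block can be led into a trap there. -/
theorem IsFlipPair.nonempty_trap_blockNeighborhood {f h : V → V} (H : IsFlipPair G f h)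
    (hadj : ∀ x y, G.Adj x y → G.Adj (f x) (f y) ∨ G.Adj (h x) (h y)) {o v z : V}
    (hv : v ∈ blockNeighborhood G f h o) (hz : z ∉ blockNeighborhood G f h o) (hvz : G.Adj v z) :
    Nonempty (Trap G (blockNeighborhood G f h o) v z) := by
  have hSf : ∀ x ∈ blockNeighborhood G f h o, f x ∈ blockNeighborhood G f h o := by
    intro x hx
    obtain ⟨y, hy, hxy⟩ := Set.mem_iUnion₂.1 hx
    exact Set.mem_biUnion hy (H.mem_block_iff.1.2 hxy)
  have hSh : ∀ x ∈ blockNeighborhood G f h o, h x ∈ blockNeighborhood G f h o := by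
    intro x hx
    obtain ⟨y, hy, hxy⟩ := Set.mem_iUnion₂.1 hx
    exact Set.mem_biUnion hy (H.mem_block_iff.2.2 hxy)
  have hQS : ∀ q ∈ block f h o, q ∈ blockNeighborhood G f h o := fun q hq =>
    Set.mem_biUnion (.inl hq) (self_mem_block f h q)
  have hQN : ∀ q ∈ block f h o, ∀ a, G.Adj q a → a ∈ blockNeighborhood G f h o := fun q hq a ha =>
    Set.mem_biUnion (.inr ⟨q, hq, ha⟩) (self_mem_block f h a)
  -- All neighbours of the central block lie in the neighbourhood, so the exit vertex `v` is on
  -- another block, while `q` and the dead end can be taken in the central one.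
  have hvQ : v ∉ block f h o := fun hvQ => hz (hQN v hvQ z hvz)
  have hfvQ : f v ∉ block f h o := fun hc => hvQ (H.mem_block_iff.1.1 hc)
  have hhvQ : h v ∉ block f h o := fun hc => hvQ (H.mem_block_iff.2.1 hc)
  have hfhvQ : f (h v) ∉ block f h o := fun hc => hhvQ (H.mem_block_iff.1.1 hc)
  have hne : ∀ {q a}, q ∈ block f h o → a ∉ block f h o → q ≠ a := fun hq ha e => ha (e ▸ hq)
  have throughH : ∀ q ∈ block f h o, G.Adj (h v) q →
      Nonempty (Trap G (blockNeighborhood G f h o) v z) := fun q hq hvq =>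
    H.nonempty_trap hSf hSh hv hz hvz (hQS q hq) hvq (hne hq hvQ) (hne hq hhvQ) (hne hq hfvQ)
      (hne hq hfhvQ) (hQN _ (H.mem_block_iff.2.2 hq))
  have throughF : ∀ q ∈ block f h o, G.Adj (f v) q →
      Nonempty (Trap G (blockNeighborhood G f h o) v z) := fun q hq hvq =>
    H.symm.nonempty_trap hSh hSf hv hz hvz (hQS q hq) hvq (hne hq hvQ) (hne hq hfvQ)
      (hne hq hhvQ) (H.comm v ▸ hne hq hfhvQ) (hQN _ (H.mem_block_iff.1.2 hq))
  obtain ⟨y, hy, hvy⟩ := Set.mem_iUnion₂.1 hv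
  rcases hy with hy | ⟨b, hb, hby⟩
  · exfalso
    rcases hvy with rfl | rfl | rfl | rfl
    · exact hvQ hy
    · exact hvQ (H.mem_block_iff.1.2 hy)
    · exact hvQ (H.mem_block_iff.2.2 hy)
    · exact hvQ (H.mem_block_iff.1.2 (H.mem_block_iff.2.2 hy))
  -- The trap needs `f v` or `h v` to be adjacent to the central block. If `v` is a flip of `y`, the
  -- edge `b y` serves; if `v` is `y` or its opposite corner, the image of that edge under the flip
  -- preserving its adjacency does.
  · rcases hvy with rfl | rfl | rfl | rfl
    · rcases hadj b _ hby with hadj | hadj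
      · exact throughF _ (H.mem_block_iff.1.2 hb) hadj.symm
      · exact throughH _ (H.mem_block_iff.2.2 hb) hadj.symm
    · exact throughF b hb (by rw [H.f_f]; exact hby.symm)
    · exact throughH b hb (by rw [H.h_h]; exact hby.symm)
    · rcases hadj b _ hby with hadj | hadj
      · exact throughH _ (H.mem_block_iff.1.2 hb) (by rw [H.comm, H.h_h]; exact hadj.symm)
      · exact throughF _ (H.mem_block_iff.2.2 hb) (by rw [H.f_f]; exact hadj.symm)

end BlockTrap

/-! ### Flips of the lattice: a tiling by two-by-two squares -/

section Lattice

variable {d : ℕ}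

/-- The reflection in direction `i` that exchanges the coordinates `2 m` and `2 m + 1`. -/
def flip (i : Fin d) (x : Fin d → ℤ) : Fin d → ℤ :=
  Function.update x i (x i + 1 - 2 * (x i % 2))

theorem flip_apply_self (i : Fin d) (x : Fin d → ℤ) : flip i x i = x i + 1 - 2 * (x i % 2) :=
  Function.update_self ..

theorem flip_apply_of_ne {i k : Fin d} (h : k ≠ i) (x : Fin d → ℤ) : flip i x k = x k :=
  Function.update_of_ne h ..

theorem adj_flip (i : Fin d) (x : Fin d → ℤ) : (hypercubicLattice d).Adj x (flip i x) := by
  change ∑ k, |x k - flip i x k| = 1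
  rw [Finset.sum_eq_single i (fun k _ hk => by simp [flip_apply_of_ne hk]) (by simp),
    flip_apply_self]
  rcases Int.emod_two_eq_zero_or_one (x i) with h | h <;> rw [h] <;> ring_nf <;> rfl

theorem adj_flip_flip {i : Fin d} {x y : Fin d → ℤ} (h : (hypercubicLattice d).Adj x y)
    (hi : x i = y i) : (hypercubicLattice d).Adj (flip i x) (flip i y) := by
  change ∑ k, |flip i x k - flip i y k| = 1
  rw [← (show ∑ k, |x k - y k| = 1 from h)]
  refine Finset.sum_congr rfl fun k _ => ?_
  by_cases hk : k = i
  · subst hk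
    rw [flip_apply_self, flip_apply_self, hi]
    simp
  · rw [flip_apply_of_ne hk, flip_apply_of_ne hk]

theorem eq_or_eq_of_adj {i j : Fin d} (hij : i ≠ j) {x y : Fin d → ℤ}
    (h : (hypercubicLattice d).Adj x y) : x i = y i ∨ x j = y j := by
  by_contra! hne
  have hle : ∑ k ∈ {i, j}, |x k - y k| ≤ ∑ k, |x k - y k| :=
    Finset.sum_le_sum_of_subset_of_nonneg (Finset.subset_univ _) fun _ _ _ => abs_nonneg _
  rw [(show ∑ k, |x k - y k| = 1 from h), Finset.sum_pair hij] at hle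
  have h1 := Int.one_le_abs (sub_ne_zero.2 hne.1)
  have h2 := Int.one_le_abs (sub_ne_zero.2 hne.2)
  omega

theorem isFlipPair_flip {i j : Fin d} (hij : i ≠ j) :
    IsFlipPair (hypercubicLattice d) (flip i) (flip j) := by
  have hinv : ∀ (i : Fin d) (x : Fin d → ℤ), flip i (flip i x) = x := by
    intro i x
    funext k
    by_cases hk : k = i
    · subst hk
      rw [flip_apply_self, flip_apply_self]
      omega
    · rw [flip_apply_of_ne hk, flip_apply_of_ne hk]
  refine ⟨hinv i, hinv j, fun x => ?_, adj_flip i, adj_flip j, fun x hx => ?_⟩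
  · funext k
    by_cases hk : k = i
    · subst hk
      rw [flip_apply_self, flip_apply_of_ne hij, flip_apply_of_ne hij, flip_apply_self]
    · by_cases hk' : k = j
      · subst hk'
        rw [flip_apply_of_ne hk, flip_apply_self, flip_apply_self, flip_apply_of_ne hk]
      · simp only [flip_apply_of_ne hk, flip_apply_of_ne hk']
  · have := congrFun hx i
    rw [flip_apply_self, flip_apply_of_ne hij] at this
    omega

end Lattice

/-! ### Absence of percolation -/

section Percolation

/-- From a finite set that meets an infinite cluster, an edge of the cluster leads to infinitely
many vertices outside the set. -/
theorem exists_adj_infinite_outside {V : Type*} {O : SimpleGraph V}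
    (hfin : ∀ x, (O.neighborSet x).Finite) {S : Set V} (hS : S.Finite) {o : V} (ho : o ∈ S)
    (hinf : {y | O.Reachable o y}.Infinite) :
    ∃ v ∈ S, ∃ z ∉ S, O.Adj v z ∧
      {w | Relation.ReflTransGen (fun x y => x ∉ S ∧ y ∉ S ∧ O.Adj x y) z w}.Infinite := by
  by_contra! hcon
  -- A walk from `o` to a vertex outside `S`, cut at its last visit to `S`, leaves by one of
  -- finitely many edges and stays outside afterwards.
  have hcover : {y | O.Reachable o y} ⊆ S ∪ ⋃ v ∈ S, ⋃ z ∈ O.neighborSet v ∩ Sᶜ,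
      {w | Relation.ReflTransGen (fun x y => x ∉ S ∧ y ∉ S ∧ O.Adj x y) z w} := by
    intro y hy
    have hy' : O.Reachable o y := hy
    rw [SimpleGraph.reachable_iff_reflTransGen] at hy'
    induction hy' with
    | refl => exact .inl ho
    | @tail x y hx hxy ih =>
      by_cases hyS : y ∈ S
      · exact .inl hyS
      refine .inr ?_
      by_cases hxS : x ∈ S
      · exact Set.mem_biUnion hxS (Set.mem_biUnion ⟨hxy, hyS⟩ .refl)
      · have := (ih ((SimpleGraph.reachable_iff_reflTransGen _ _).2 hx)).resolve_left hxS
        obtain ⟨v, hv, this⟩ := Set.mem_iUnion₂.1 this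
        obtain ⟨z, hz, this⟩ := Set.mem_iUnion₂.1 this
        exact Set.mem_biUnion hv (Set.mem_biUnion hz (.tail this ⟨hxS, hyS, hxy⟩))
  refine hinf ((hS.union (hS.biUnion fun v hv => ((hfin v).subset Set.inter_subset_left).biUnion
    fun z hz => ?_)).subset hcover)
  exact hcon v hv z hz.2 hz.1

theorem ae_finite_cluster {d : ℕ} (hd : 2 ≤ d) (t : unitInterval) (o : Fin d → ℤ) :
    ∀ᵐ U ∂(clockLaw (hypercubicLattice d)),
      {v | (openGraph (hypercubicLattice d) (fun _ => 2) U t).Reachable o v}.Finite := by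
  have hfin := finite_neighborSet_hypercubicLattice (d := d)
  have hij : (⟨0, by omega⟩ : Fin d) ≠ ⟨1, by omega⟩ := by simp
  have hflip := isFlipPair_flip hij
  set f := flip (⟨0, by omega⟩ : Fin d)
  set h := flip (⟨1, by omega⟩ : Fin d)
  have hS := finite_blockNeighborhood hfin f h o
  have ho : o ∈ blockNeighborhood (hypercubicLattice d) f h o :=
    Set.mem_biUnion (.inl (self_mem_block f h o)) (self_mem_block f h o)
  -- Resampling must keep accessibility along with the absence of ends, because the modified clocks
  -- `W` have to obey the recursion for the trap to work.
  filter_upwards [ae_exists_resample ((ae_forall_acc d).and (ae_not_isInfiniteEnd d t)),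
    ae_forall_acc d, ae_clock_injective, ae_clock_lt_one] with U hres hacc hinj h1
  by_contra hinf
  obtain ⟨v, hv, z, hz, hvz, hout⟩ := exists_adj_infinite_outside
    (O := openGraph (hypercubicLattice d) (fun _ => 2) U t)
    (fun x => (hfin x).subset fun _ hy => hy.1) hS ho hinf
  obtain ⟨T⟩ := hflip.nonempty_trap_blockNeighborhood
    (fun x y hxy => (eq_or_eq_of_adj hij hxy).imp (adj_flip_flip hxy) (adj_flip_flip hxy))
    hv hz hvz.1
  obtain ⟨F, I, hI, hpos, hW⟩ := T.exists_box hfin hS hinj hacc h1 hvz hout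
  obtain ⟨W, hWF, hWU, hWacc, hWend⟩ := hres F I hI hpos
  exact hWend T.c (hW W hWF hWU hWacc)

end Percolation

end ConstrainedDegree

theorem proposition2 (d : ℕ) (hd : 2 ≤ d) (t : unitInterval) :
    ConstrainedDegree.percolationProb (ConstrainedDegree.hypercubicLattice d)
      (fun _ => 2) 0 t = 0 := by
  rw [ConstrainedDegree.percolationProb]
  have h := ConstrainedDegree.ae_finite_cluster hd t 0
  rw [ae_iff] at h
  exact h
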